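/- **Setting.** Let $m\ge 1$, and let $N$, $n$, $k$ be natural numbers with $k\le n+1$. The decision variable is the vector $\mathbf c=(c^j_{i,\mu})$ of Bezier control points (piece $i\in\{1,\dots,N\}$, coordinate $\mu\in\{1,\dots,m\}$, $j\in\{0,\dots,n\}$). For each piece $i$ the lower and upper corridor bounds $\tilde{\mathbf s}^l_i,\tilde{\mathbf s}^u_i\in\mathbb R^m$ are random vectors with unknown laws. For $h\in\{l,u\}$ let $\epsilon^h_i\in(0,0.5)$, $\theta^h_i\ge 0$, $\boldsymbol\mu^h_i\in\mathbb R^m$, $\mathbf\Sigma^h_i\succ 0$, and let $\hat{\mathbb P}^h_i$ be the elliptical law on $\mathbb R^m$ whose density is proportional to $\mathbf x\mapsto g^h_i\big(\tfrac12(\mathbf x-\boldsymbol\mu^h_i)^\top(\mathbf\Sigma^h_i)^{-1}(\mathbf x-\boldsymbol\mu^h_i)\big)$. Here $g^h_i\ge0$ is measurable and $\int_{\mathbb R^m} g^h_i(|\mathbf x|^2/2)\,d\mathbf x\in(0,\infty)$. Let $\mathcal F^h_i$ be the set of all Borel probability measures $\mathbb P$ on $\mathbb R^m$ with $d_W(\hat{\mathbb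 P}^h_i,\mathbb P)\le\theta^h_i$, where $$d_W(\mathbb P_1,\mathbb P_2)=\inf_{\pi}\int \|\mathbf s_1-\mathbf s_2\|_{\mathbf\Sigma^h_i}\,d\pi(\mathbf s_1,\mathbf s_2),\qquad \|\mathbf x\|_{\mathbf\Sigma}=\sqrt{\mathbf x^\top\mathbf\Sigma^{-1}\mathbf x},$$ and $\pi$ ranges over all joint laws with marginals $\mathbb P_1,\mathbb P_2$. **Reference quantile and tightened risk level.** Let $$\bar g^h_i(z)=\int_{\mathbb R^{m-1}}g^h_i\big(z+\tfrac12|\mathbf y|^2\big)\,d\mathbf y,\qquad k^h_i=\Big(\int_{\mathbb R}\bar g^h_i(x^2/2)\,dx\Big)^{-1}$$ be the generating function and normalizing constant of the standardized one-dimensional marginal (for $m=1$, $\bar g^h_i=g^h_i$). Let $\Phi^h_i(x)=\int_{-\infty}^x k^h_i\,\bar g^h_i(t^2/2)\,dt$ be its distribution function and $(\Phi^h_i)^{-1}(p)=\inf\{x:\Phi^h_i(x)\ge p\}$. Let $\eta^{*}=\eta^{*,h}_i$ be the least $\eta$ such that $$\eta\ge(\Phi^h_i)^{-1}(1-\epsilon^h_i),\qquad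 \eta\big(\Phi^h_i(\eta)-(1-\epsilon^h_i)\big)-\int_{\frac12((\Phi^h_i)^{-1}(1-\epsilon^h_i))^2}^{\eta^2/2}k^h_i\,\bar g^h_i(z)\,dz\ \ge\ \theta^h_i ,$$ and set $\underline\epsilon^h_i=1-\Phi^h_i(\eta^{*,h}_i)$. Assume that the inverse of $\Phi^h_i$ is genuine: $\Phi^h_i$ is strictly increasing on $\{x: 0<\Phi^h_i(x)<1\}$, and $\underline\epsilon^h_i>0$ (both hold, for example, if $g^h_i>0$ everywhere). **The problems.** Let $\mathbf Q\succ0$, $\tau_i>0$, and let $d^{(l)}_{1,\mu},d^{(l)}_{N,\mu},a^l_{\min},a^l_{\max}$ be given reals. Put $a^{0,j}_{i,\mu}=c^j_{i,\mu}$ and $a^{l,j}_{i,\mu}=\frac{n!}{(n-l)!}\big(a^{l-1,j+1}_{i,\mu}-a^{l-1,j}_{i,\mu}\big)$ for $1\le l\le n$, $0\le j\le n-l$. The *common constraints* are, for all $\mu$: - $a^{l,0}_{1,\mu}\tau_1^{1-l}=d^{(l)}_{1,\mu}$ and $a^{l,n-l}_{N,\mu}\tau_N^{1-l}=d^{(l)}_{N,\mu}$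 for $0\le l\le n$; - $a^{l,n-l}_{i,\mu}\tau_i^{1-l}=a^{l,0}_{i+1,\mu}\tau_{i+1}^{1-l}$ for $1\le i<N$ and $0\le l\le k-1$; - $a^l_{\min}\le a^{l,j}_{i,\mu}\tau_i^{1-l}\le a^l_{\max}$ for all $i$, $1\le l\le k-1$ and $0\le j\le n-l$. The *robust problem* minimizes $\mathbf c^\top\mathbf Q\mathbf c$ subject to the common constraints and, for all $i,\mu,j$, $$\mathbb P(\mathbf e_\mu^\top\tilde{\mathbf s}^l_i\le c^j_{i,\mu})\ge1-\epsilon^l_i\ \ \forall\,\mathbb P\in\mathcal F^l_i,\qquad \mathbb P(\mathbf e_\mu^\top\tilde{\mathbf s}^u_i\ge c^j_{i,\mu})\ge1-\epsilon^u_i\ \ \forall\,\mathbb P\in\mathcal F^u_i .$$ The *deterministic problem* minimizes $\mathbf c^\top\mathbf Q\mathbf c$ subject to the common constraints and, for all $i,\mu,j$, $$c^j_{i,\mu}\ge\mathbf e_\mu^\top\boldsymbol\mu^l_i+\sqrt{\mathbf e_\mu^\top\mathbf\Sigma^l_i\mathbf e_\mu}\,(\Phi^l_i)^{-1}(1-\underline\epsilon^l_i),\qquad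 c^j_{i,\mu}\le\mathbf e_\mu^\top\boldsymbol\mu^u_i-\sqrt{\mathbf e_\mu^\top\mathbf\Sigma^u_i\mathbf e_\mu}\,(\Phi^u_i)^{-1}(1-\underline\epsilon^u_i).$$ **Theorem.** Each $\eta^{*,h}_i$ exists (the minimum is attained), and $\underline\epsilon^h_i\le\epsilon^h_i$. Each robust chance constraint is equivalent to the corresponding deterministic linear bound. Consequently the robust and the deterministic problem have the same feasible set, the same minimizers and the same optimal value. The deterministic problem is a convex quadratic program: its objective is a convex quadratic function, and its feasible set is defined by finitely many linear inequalities. -/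

import Mathlib

open MeasureTheory Set
open scoped ENNReal Matrix

namespace DRSCC

/-! ### Wasserstein distance with the Mahalanobis norm -/

/-- The Mahalanobis norm `√(xᵀ S⁻¹ x)`. -/
noncomputable def mahalanobis {m : ℕ} (S : Matrix (Fin m) (Fin m) ℝ) (x : Fin m → ℝ) : ℝ :=
  √(x ⬝ᵥ (S⁻¹ *ᵥ x))

/-- `π` is a joint law with marginals `P₁` and `P₂`. -/
def IsCoupling {m : ℕ} (P₁ P₂ : Measure (Fin m → ℝ))
    (π : Measure ((Fin m → ℝ) × (Fin m → ℝ))) : Prop :=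
  π.map Prod.fst = P₁ ∧ π.map Prod.snd = P₂

/-- The type-1 Wasserstein distance whose ground metric is the Mahalanobis norm of `S`. -/
noncomputable def wasserstein {m : ℕ} (S : Matrix (Fin m) (Fin m) ℝ)
    (P₁ P₂ : Measure (Fin m → ℝ)) : ℝ≥0∞ :=
  ⨅ (π : Measure ((Fin m → ℝ) × (Fin m → ℝ))) (_ : IsCoupling P₁ P₂ π),
    ∫⁻ z, ENNReal.ofReal (mahalanobis S (z.1 - z.2)) ∂π

/-! ### Elliptical distributions -/

/-- `g` generates a density on `ℝᵐ`: it is measurable, nonnegative on `[0, ∞)`, and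
`x ↦ g (|x|² / 2)` has a finite positive integral over `ℝᵐ`. -/
def IsGenerator (m : ℕ) (g : ℝ → ℝ) : Prop :=
  Measurable g ∧ (∀ z, 0 ≤ z → 0 ≤ g z) ∧
    (∫⁻ x : Fin m → ℝ, ENNReal.ofReal (g (x ⬝ᵥ x / 2))) ≠ 0 ∧
    (∫⁻ x : Fin m → ℝ, ENNReal.ofReal (g (x ⬝ᵥ x / 2))) ≠ ∞

/-- The unnormalized elliptical density `g ((x - μ)ᵀ S⁻¹ (x - μ) / 2)`. -/
noncomputable def ellipticalWeight {m : ℕ} (μ : Fin m → ℝ) (S : Matrix (Fin m) (Fin m) ℝ)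
    (g : ℝ → ℝ) (x : Fin m → ℝ) : ℝ≥0∞ :=
  ENNReal.ofReal (g ((x - μ) ⬝ᵥ (S⁻¹ *ᵥ (x - μ)) / 2))

/-- The elliptical law on `ℝᵐ` with location `μ`, matrix `S` and generating function `g`. Its
density is `ellipticalWeight μ S g`, divided by its integral. By symmetry, `μ` is the mean vector
whenever the mean exists. -/
noncomputable def ellipticalLaw {m : ℕ} (μ : Fin m → ℝ) (S : Matrix (Fin m) (Fin m) ℝ)
    (g : ℝ → ℝ) : Measure (Fin m → ℝ) :=
  (∫⁻ x, ellipticalWeight μ S g x)⁻¹ • volume.withDensity (ellipticalWeight μ S g)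

/-- The generating function of the one-dimensional marginals of the elliptical laws on `ℝᵐ`
generated by `g`, obtained by integrating out the `m - 1` orthogonal coordinates. For `m = 1` it is
`g` itself. -/
noncomputable def marginalGenerator (m : ℕ) (g : ℝ → ℝ) (z : ℝ) : ℝ :=
  ∫ y : Fin (m - 1) → ℝ, g (z + y ⬝ᵥ y / 2)

/-- The normalizing constant of the standard univariate elliptical density
`x ↦ k * marginalGenerator m g (x² / 2)`. -/
noncomputable def normConst (m : ℕ) (g : ℝ → ℝ) : ℝ :=
  (∫ x : ℝ, marginalGenerator m g (x ^ 2 / 2))⁻¹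

/-- The standard univariate elliptical cumulative distribution function. -/
noncomputable def stdCDF (m : ℕ) (g : ℝ → ℝ) (x : ℝ) : ℝ :=
  ∫ t in Iic x, normConst m g * marginalGenerator m g (t ^ 2 / 2)

/-- The inverse (quantile function) of a distribution function. -/
noncomputable def quantile (F : ℝ → ℝ) (p : ℝ) : ℝ := sInf {x | p ≤ F x}

/-! ### Ambiguity sets and the tightened risk level -/

/-- An ambiguity set around an elliptical reference law, and a risk threshold. -/
structure Ambiguity (m : ℕ) where
  /-- location (mean) vector of the reference law -/
  mean : Fin m → ℝ
  /-- matrix of the reference law and of the Mahalanobis norm -/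
  Sigma : Matrix (Fin m) (Fin m) ℝ
  /-- generating function of the reference law -/
  g : ℝ → ℝ
  /-- radius of the Wasserstein ball -/
  θ : ℝ
  /-- risk threshold -/
  ε : ℝ
  sigma_posDef : Sigma.PosDef
  isGenerator : IsGenerator m g
  θ_nonneg : 0 ≤ θ
  ε_pos : 0 < ε
  ε_lt : ε < 1 / 2

namespace Ambiguity

variable {m : ℕ} (A : Ambiguity m)

/-- The reference law. -/
noncomputable def refLaw : Measure (Fin m → ℝ) := ellipticalLaw A.mean A.Sigma A.g

/-- The Wasserstein ball: all Borel probability laws on `ℝᵐ` within distance `θ` of the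
reference law. -/
def ball : Set (Measure (Fin m → ℝ)) :=
  {P | IsProbabilityMeasure P ∧ wasserstein A.Sigma A.refLaw P ≤ ENNReal.ofReal A.θ}

/-- The standardized reference distribution function. -/
noncomputable def Φ (x : ℝ) : ℝ := stdCDF m A.g x

/-- Its inverse. -/
noncomputable def Φinv (p : ℝ) : ℝ := quantile A.Φ p

/-- The integral `κ` as a function of `η`. -/
noncomputable def kappa (η : ℝ) : ℝ :=
  ∫ z in ((A.Φinv (1 - A.ε)) ^ 2 / 2)..(η ^ 2 / 2), normConst m A.g * marginalGenerator m A.g z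

/-- The feasible set of the one-dimensional problem that defines `η*`. -/
def etaFeasible : Set ℝ :=
  {η | A.Φinv (1 - A.ε) ≤ η ∧ A.θ ≤ η * (A.Φ η - (1 - A.ε)) - A.kappa η}

/-- `η*`, the least element of `etaFeasible`. -/
noncomputable def etaStar : ℝ := sInf A.etaFeasible

/-- The tightened risk level `1 - Φ(η*)`. -/
noncomputable def epsLow : ℝ := 1 - A.Φ A.etaStar

/-- Robust chance constraint for a lower corridor bound `s`, in coordinate `ν`:
`P(e_νᵀ s ≤ c) ≥ 1 - ε` for every law `P` in the ball. -/
def RobustLower (ν : Fin m) (c : ℝ) : Prop :=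
  ∀ P ∈ A.ball, ENNReal.ofReal (1 - A.ε) ≤ P {s | (Pi.single ν 1 : Fin m → ℝ) ⬝ᵥ s ≤ c}

/-- Robust chance constraint for an upper corridor bound `s`, in coordinate `ν`:
`P(e_νᵀ s ≥ c) ≥ 1 - ε` for every law `P` in the ball. -/
def RobustUpper (ν : Fin m) (c : ℝ) : Prop :=
  ∀ P ∈ A.ball, ENNReal.ofReal (1 - A.ε) ≤ P {s | c ≤ (Pi.single ν 1 : Fin m → ℝ) ⬝ᵥ s}

/-- The deterministic lower bound `e_νᵀ μ + √(e_νᵀ Σ e_ν) Φ⁻¹(1 - ε̲)`. -/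
noncomputable def lowerBound (ν : Fin m) : ℝ :=
  (Pi.single ν 1 : Fin m → ℝ) ⬝ᵥ A.mean +
    √((Pi.single ν 1 : Fin m → ℝ) ⬝ᵥ (A.Sigma *ᵥ (Pi.single ν 1))) * A.Φinv (1 - A.epsLow)

/-- The deterministic upper bound `e_νᵀ μ - √(e_νᵀ Σ e_ν) Φ⁻¹(1 - ε̲)`. -/
noncomputable def upperBound (ν : Fin m) : ℝ :=
  (Pi.single ν 1 : Fin m → ℝ) ⬝ᵥ A.mean -
    √((Pi.single ν 1 : Fin m → ℝ) ⬝ᵥ (A.Sigma *ᵥ (Pi.single ν 1))) * A.Φinv (1 - A.epsLow)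

/-- The reference distribution function has an inverse at the levels where the inverse is used: it
is strictly increasing where its values lie in `(0, 1)`, and the tightened level `1 - ε̲` is
below `1`. -/
def Invertible : Prop := StrictMonoOn A.Φ {x | A.Φ x ∈ Ioo 0 1} ∧ 0 < A.epsLow

end Ambiguity

/-! ### The trajectory optimization problems -/

/-- Index `(i, ν, j)` of a control point: piece, coordinate, number within the piece. -/
abbrev CtrlIdx (N m n : ℕ) : Type := Fin N × Fin m × Fin (n + 1)

/-- The control points of derivatives of a Bezier piece of degree `n` with control points `c`:
`a^{0,j} = c^j` and `a^{l,j} = n!/(n-l)! * (a^{l-1,j+1} - a^{l-1,j})`. Only the entries with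
`l ≤ n` and `j ≤ n - l` are ever used. -/
noncomputable def derivPoint (n : ℕ) (c : ℕ → ℝ) : ℕ → ℕ → ℝ
  | 0, j => c j
  | l + 1, j => (n.factorial : ℝ) / ((n - (l + 1)).factorial : ℝ) *
      (derivPoint n c l (j + 1) - derivPoint n c l j)

/-- The control points of piece `i` in coordinate `ν`, as a sequence (zero after the last one). -/
def pieceSeq {N m n : ℕ} (c : CtrlIdx N m n → ℝ) (i : Fin N) (ν : Fin m) (j : ℕ) : ℝ :=
  if h : j < n + 1 then c (i, ν, ⟨j, h⟩) else 0

/-- `a_{i,ν}^{l,j}`. -/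
noncomputable def aPoint {N m n : ℕ} (c : CtrlIdx N m n → ℝ) (i : Fin N) (ν : Fin m)
    (l j : ℕ) : ℝ :=
  derivPoint n (pieceSeq c i ν) l j

/-- The data of a trajectory optimization problem with `N` Bezier pieces of degree `n` in `ℝᵐ`,
continuous up to the derivative of order `k - 1`, in an uncertain corridor. -/
structure TrajData (N m n k : ℕ) where
  /-- cost matrix -/
  Q : Matrix (CtrlIdx N m n) (CtrlIdx N m n) ℝ
  /-- time scale of each piece -/
  τ : Fin N → ℝ
  /-- prescribed initial derivatives, by order and coordinate -/
  dInit : ℕ → Fin m → ℝ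
  /-- prescribed final derivatives, by order and coordinate -/
  dGoal : ℕ → Fin m → ℝ
  /-- lower limits of derivatives, by order -/
  aMin : ℕ → ℝ
  /-- upper limits of derivatives, by order -/
  aMax : ℕ → ℝ
  /-- ambiguity set of the lower corner of each corridor cell -/
  lower : Fin N → Ambiguity m
  /-- ambiguity set of the upper corner of each corridor cell -/
  upper : Fin N → Ambiguity m
  Q_posDef : Q.PosDef
  τ_pos : ∀ i, 0 < τ i
  k_le : k ≤ n + 1

namespace TrajData

variable {N m n k : ℕ} (D : TrajData N m n k)

/-- The objective `cᵀ Q c`. -/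
def objective (c : CtrlIdx N m n → ℝ) : ℝ := c ⬝ᵥ (D.Q *ᵥ c)

/-- The boundary, continuity and derivative-limit constraints, which do not involve the corridor.
A derivative of order `l` of a piece has the control points `0, …, n - l`. -/
structure CommonConstraints (c : CtrlIdx N m n → ℝ) : Prop where
  initial : ∀ i : Fin N, i.val = 0 → ∀ ν : Fin m, ∀ l ≤ n,
    aPoint c i ν l 0 * D.τ i ^ (1 - (l : ℤ)) = D.dInit l ν
  final : ∀ i : Fin N, i.val + 1 = N → ∀ ν : Fin m, ∀ l ≤ n,
    aPoint c i ν l (n - l) * D.τ i ^ (1 - (l : ℤ)) = D.dGoal l ν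
  continuity : ∀ i i' : Fin N, i.val + 1 = i'.val → ∀ ν : Fin m, ∀ l < k,
    aPoint c i ν l (n - l) * D.τ i ^ (1 - (l : ℤ)) = aPoint c i' ν l 0 * D.τ i' ^ (1 - (l : ℤ))
  limits : ∀ (i : Fin N) (ν : Fin m), ∀ l, 1 ≤ l → l < k → ∀ j ≤ n - l,
    D.aMin l ≤ aPoint c i ν l j * D.τ i ^ (1 - (l : ℤ)) ∧
      aPoint c i ν l j * D.τ i ^ (1 - (l : ℤ)) ≤ D.aMax l

/-- Feasible set of the problem with distributionally robust chance constraints. -/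
def robustFeasible : Set (CtrlIdx N m n → ℝ) :=
  {c | (∀ i ν j, (D.lower i).RobustLower ν (c (i, ν, j)) ∧
      (D.upper i).RobustUpper ν (c (i, ν, j))) ∧ D.CommonConstraints c}

/-- Feasible set of the deterministic problem. -/
def qpFeasible : Set (CtrlIdx N m n → ℝ) :=
  {c | (∀ i ν j, (D.lower i).lowerBound ν ≤ c (i, ν, j) ∧
      c (i, ν, j) ≤ (D.upper i).upperBound ν) ∧ D.CommonConstraints c}

end TrajData

/-- Minimizing `f` over `S` is a convex quadratic program: `f` is a quadratic function with positive
semidefinite matrix, and `S` is the solution set of finitely many linear inequalities. -/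
def IsConvexQP {ι : Type} [Fintype ι] (f : (ι → ℝ) → ℝ) (S : Set (ι → ℝ)) : Prop :=
  (∃ (Q : Matrix ι ι ℝ) (q : ι → ℝ) (r : ℝ), Q.PosSemidef ∧
    ∀ c, f c = c ⬝ᵥ (Q *ᵥ c) + q ⬝ᵥ c + r) ∧
  ∃ (p : ℕ) (A : Matrix (Fin p) ι ℝ) (b : Fin p → ℝ), S = {c | A *ᵥ c ≤ b}

/-- The solution set of `min f` over `S`. -/
def minimizers {V : Type} (f : V → ℝ) (S : Set V) : Set V := {c | c ∈ S ∧ ∀ c' ∈ S, f c ≤ f c'}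

/-- The optimal value of `min f` over `S` (`⊤` if there is no feasible point). -/
noncomputable def optValue {V : Type} (f : V → ℝ) (S : Set V) : EReal := ⨅ c ∈ S, (f c : EReal)

end DRSCC

/-!
Fix a reference law with matrix `Σ`, and a linear functional `a ≠ 0`. Write `Y` for the standardized
score `(aᵀs - aᵀμ) / √(aᵀΣa)`.

* Reduction to one dimension. In coordinates in which `Σ⁻¹` is the standard inner product and the
  first of which is `Y`, the reference density is rotation invariant; integrating out the other
  coordinates gives `Y` the distribution function `Φ`, whatever `a` is (`map_ellipticalLaw`). By
  Cauchy–Schwarz a move of Mahalanobis length `r` changes `Y` by at most `r`, with equality along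
  `Σ a` (`abs_score_sub_score_le`, `score_add_smul`). The chance constraint `P(aᵀs ≤ x) ≥ 1 - ε`
  thus asks whether mass can be pushed above the level `η = (x - aᵀμ) / √(aᵀΣa)` within a budget `θ`.

* The transport cost. Let `q = Φ⁻¹(1 - ε)`. The cheapest way to raise `P(Y > η)` to `ε` is to move
  the reference mass on `(q, η]` up to `η`, at the cost `∫ (η - y) dΦ(y) = ∫_q^η (Φ(s) - (1 - ε)) ds`.
  Integration by parts and the substitution `z = y² / 2` identify this with the expression that
  defines `η*` (`mul_Φ_sub_kappa`). It is continuous, monotone and unbounded in `η ≥ q`, so `η*` is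
  attained and the levels that satisfy its constraint are exactly those above it
  (`isLeast_etaStar`, `mem_etaFeasible_iff`).

* Worst case. If the cost is below `θ`, moving the mass on `(q - δ, η]` to `η + δ` gives, for small
  `δ > 0`, a law in the ball that violates the constraint (`exists_measure_lt_of_notMem_etaFeasible`).
  If the cost is at least `θ`, a pointwise dual inequality (`le_transport_integrand`), integrated
  against any coupling, shows that every violating law is at a distance greater than `θ`
  (`le_measure_of_mem_etaFeasible`). No moment of the reference law is needed.

Since `Φ` has an inverse at `Φ(η*)`, `Φ⁻¹(1 - ε̲) = η*`. Taking `a = e_ν` and `a = -e_ν` gives the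
deterministic bounds. The remaining constraints are linear in the control points, so the
deterministic feasible set is a polyhedron.
-/

namespace DRSCC

/-! ### Whitening a positive definite matrix -/

lemma dotProduct_mulVec_pos_of_posDef {m : ℕ} {S : Matrix (Fin m) (Fin m) ℝ} (hS : S.PosDef)
    {a : Fin m → ℝ} (ha : a ≠ 0) : 0 < a ⬝ᵥ (S *ᵥ a) := by
  simpa using hS.dotProduct_mulVec_pos ha

open scoped MatrixOrder in
/-- There are coordinates `B x` in which `S⁻¹` becomes the standard inner product, and the first of
which is the normalized functional `a`. -/
lemma exists_whitening {m : ℕ} {S : Matrix (Fin m) (Fin m) ℝ} (hS : S.PosDef)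
    {a : Fin m → ℝ} (ha : a ≠ 0) (i₀ : Fin m) :
    ∃ B : Matrix (Fin m) (Fin m) ℝ, B.det ≠ 0 ∧ S⁻¹ = Bᵀ * B ∧
      ∀ x, (B *ᵥ x) i₀ = a ⬝ᵥ x / √(a ⬝ᵥ (S *ᵥ a)) := by
  have hσ := dotProduct_mulVec_pos_of_posDef hS ha
  -- With `S = Cᵀ C`, the vector `C a / σ` is a unit vector. Extend it to an orthonormal basis, the
  -- rows of `U`, and take `B = U C⁻ᵀ`.
  obtain ⟨C, hC, hSC⟩ := CStarAlgebra.isStrictlyPositive_iff_eq_star_mul_self.mp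
    hS.isStrictlyPositive
  replace hSC : S = Cᵀ * C := by simpa [Matrix.star_eq_conjTranspose] using hSC
  have hCd : IsUnit C.det := (Matrix.isUnit_iff_isUnit_det C).mp hC
  have hCd' : IsUnit Cᵀ.det := by rwa [Matrix.det_transpose]
  set σ := √(a ⬝ᵥ (S *ᵥ a)) with hσd
  have hσ0 : 0 < σ := Real.sqrt_pos.mpr hσ
  set u : EuclideanSpace ℝ (Fin m) := WithLp.toLp 2 (σ⁻¹ • (C *ᵥ a)) with hu
  have hCa : (C *ᵥ a) ⬝ᵥ (C *ᵥ a) = σ ^ 2 := by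
    rw [Real.sq_sqrt hσ.le, hSC, ← Matrix.mulVec_mulVec, Matrix.dotProduct_mulVec a,
      Matrix.vecMul_transpose]
  have hunit : inner ℝ u u = 1 := by
    rw [EuclideanSpace.inner_eq_star_dotProduct]
    simp only [hu, star_trivial, smul_dotProduct, dotProduct_smul, hCa, smul_eq_mul]
    field_simp
  have hon : Orthonormal ℝ (({i₀} : Set (Fin m)).domRestrict (fun _ : Fin m => u)) := by
    refine ⟨fun i => ?_, fun i j hij => (hij (Subsingleton.elim i j)).elim⟩
    have : ‖u‖ ^ 2 = 1 := by rw [← real_inner_self_eq_norm_sq, hunit]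
    simpa using (pow_eq_one_iff_of_nonneg (norm_nonneg u) two_ne_zero).mp this
  obtain ⟨b, hb⟩ := hon.exists_orthonormalBasis_extension_of_card_eq (by simp)
  have hb0 : b i₀ = u := hb i₀ rfl
  let U : Matrix (Fin m) (Fin m) ℝ := Matrix.of fun i j => (b i).ofLp j
  have hUU : U * Uᵀ = 1 := by
    ext i j
    have := b.inner_eq_ite i j
    rw [EuclideanSpace.inner_eq_star_dotProduct] at this
    rw [Matrix.mul_apply, Matrix.one_apply, ← this]
    simp [dotProduct, U, mul_comm]
  have hUU' : Uᵀ * U = 1 := mul_eq_one_comm.mp hUU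
  have hUrow : U i₀ = σ⁻¹ • (C *ᵥ a) := by
    change (b i₀).ofLp = _
    rw [hb0]
  refine ⟨U * Cᵀ⁻¹, ?_, ?_, fun x => ?_⟩
  · rw [Matrix.det_mul]
    refine mul_ne_zero ?_ ?_
    · intro h
      have := congrArg Matrix.det hUU
      rw [Matrix.det_mul, h] at this
      simp at this
    · exact ((Matrix.isUnit_nonsing_inv_det_iff).mpr hCd').ne_zero
  · rw [Matrix.transpose_mul, Matrix.mul_assoc, ← Matrix.mul_assoc Uᵀ, hUU', Matrix.one_mul, hSC,
      Matrix.mul_inv_rev, Matrix.transpose_nonsing_inv, Matrix.transpose_transpose]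
  · rw [← Matrix.mulVec_mulVec]
    change U i₀ ⬝ᵥ _ = _
    rw [hUrow, smul_dotProduct, Matrix.dotProduct_mulVec, ← Matrix.mulVec_transpose,
      Matrix.transpose_nonsing_inv, Matrix.transpose_transpose, Matrix.mulVec_mulVec,
      Matrix.nonsing_inv_mul _ hCd, Matrix.one_mulVec, smul_eq_mul]
    field_simp

/-- Cauchy–Schwarz for the inner products of `S` and `S⁻¹`. -/
lemma abs_dotProduct_div_le_mahalanobis {m : ℕ} {S : Matrix (Fin m) (Fin m) ℝ} (hS : S.PosDef)
    {a : Fin m → ℝ} (ha : a ≠ 0) (x : Fin m → ℝ) :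
    |a ⬝ᵥ x / √(a ⬝ᵥ (S *ᵥ a))| ≤ mahalanobis S x := by
  obtain ⟨i₀⟩ : Nonempty (Fin m) := by
    by_contra h
    rw [not_nonempty_iff] at h
    exact ha (Subsingleton.elim _ _)
  obtain ⟨B, -, hB, hB0⟩ := exists_whitening hS ha i₀
  rw [← hB0, mahalanobis]
  refine Real.abs_le_sqrt ?_
  rw [hB, ← Matrix.mulVec_mulVec, Matrix.dotProduct_mulVec, Matrix.vecMul_transpose, dotProduct]
  simp_rw [← pow_two]
  exact Finset.single_le_sum (f := fun i => (B *ᵥ x) i ^ 2) (fun i _ => sq_nonneg _)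
    (Finset.mem_univ i₀)

lemma measurable_mahalanobis {m : ℕ} (S : Matrix (Fin m) (Fin m) ℝ) :
    Measurable (mahalanobis S) := by
  refine Continuous.measurable ?_
  unfold mahalanobis
  exact Real.continuous_sqrt.comp
    (Continuous.dotProduct continuous_id (Continuous.matrix_mulVec continuous_const continuous_id))

/-- The direction `S a`, along which moving mass changes the functional `a` at the least cost. -/
lemma mahalanobis_smul_mulVec {m : ℕ} {S : Matrix (Fin m) (Fin m) ℝ} (hS : S.PosDef)
    {a : Fin m → ℝ} (r : ℝ) :
    mahalanobis S (r • (S *ᵥ a)) = |r| * √(a ⬝ᵥ (S *ᵥ a)) := by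
  have hu : IsUnit S.det := (Matrix.isUnit_iff_isUnit_det S).mp hS.isUnit
  rw [mahalanobis, Matrix.mulVec_smul, Matrix.mulVec_mulVec, Matrix.nonsing_inv_mul _ hu,
    Matrix.one_mulVec, smul_dotProduct, dotProduct_smul, smul_eq_mul, smul_eq_mul, ← mul_assoc,
    Real.sqrt_mul (mul_self_nonneg r), Real.sqrt_mul_self_eq_abs, dotProduct_comm]

/-! ### One-dimensional marginals of elliptical laws -/

/-- The unnormalized density at `t` of the standardized one-dimensional marginal, as an extended
nonnegative real: the integral of `g (|x|² / 2)` over the hyperplane `x₀ = t`. -/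
noncomputable def marginalDensity (m : ℕ) (g : ℝ → ℝ) (t : ℝ) : ℝ≥0∞ :=
  ∫⁻ y : Fin (m - 1) → ℝ, ENNReal.ofReal (g (t ^ 2 / 2 + y ⬝ᵥ y / 2))

/-- The law of the standardized one-dimensional marginal. -/
noncomputable def stdLaw (m : ℕ) (g : ℝ → ℝ) : Measure ℝ :=
  (∫⁻ t, marginalDensity m g t)⁻¹ • volume.withDensity (marginalDensity m g)

lemma measurable_dotProduct_self (d : ℕ) : Measurable fun y : Fin d → ℝ => y ⬝ᵥ y :=
  (Continuous.dotProduct continuous_id continuous_id).measurable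

lemma measurable_generator_split (d : ℕ) {g : ℝ → ℝ} (hg : Measurable g) :
    Measurable fun p : ℝ × (Fin d → ℝ) =>
      ENNReal.ofReal (g (p.1 ^ 2 / 2 + p.2 ⬝ᵥ p.2 / 2)) := by
  have h : Measurable fun p : ℝ × (Fin d → ℝ) => p.2 ⬝ᵥ p.2 :=
    (measurable_dotProduct_self d).comp measurable_snd
  exact (hg.comp (((measurable_fst.pow_const 2).div_const 2).add (h.div_const 2))).ennreal_ofReal

lemma measurable_marginalDensity (m : ℕ) {g : ℝ → ℝ} (hg : Measurable g) :
    Measurable (marginalDensity m g) := by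
  exact Measurable.lintegral_prod_right' (measurable_generator_split (m - 1) hg)

lemma dotProduct_self_nonneg_real {d : ℕ} (y : Fin d → ℝ) : 0 ≤ y ⬝ᵥ y :=
  Finset.sum_nonneg fun _ _ => mul_self_nonneg _

lemma marginalGenerator_sq_div_two {m : ℕ} {g : ℝ → ℝ} (hg : IsGenerator m g) (t : ℝ) :
    marginalGenerator m g (t ^ 2 / 2) = (marginalDensity m g t).toReal := by
  unfold marginalGenerator marginalDensity
  refine integral_eq_lintegral_of_nonneg_ae (Filter.Eventually.of_forall fun y => hg.2.1 _ ?_) ?_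
  · have := dotProduct_self_nonneg_real y
    positivity
  · exact (hg.1.comp (((measurable_dotProduct_self _).div_const 2).const_add _)).aestronglyMeasurable

/-- Integrating out all coordinates but the first. -/
lemma lintegral_mul_marginalDensity {d : ℕ} {g : ℝ → ℝ} (hg : Measurable g) {f : ℝ → ℝ≥0∞}
    (hf : Measurable f) :
    ∫⁻ y : Fin (d + 1) → ℝ, f (y 0) * ENNReal.ofReal (g (y ⬝ᵥ y / 2)) =
      ∫⁻ t, f t * marginalDensity (d + 1) g t := by
  let e := MeasurableEquiv.piFinSuccAbove (fun _ : Fin (d + 1) => ℝ) 0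
  have hmp : MeasurePreserving e volume volume :=
    volume_preserving_piFinSuccAbove (fun _ : Fin (d + 1) => ℝ) 0
  let h : ℝ × (Fin d → ℝ) → ℝ≥0∞ := fun p =>
    f p.1 * ENNReal.ofReal (g (p.1 ^ 2 / 2 + p.2 ⬝ᵥ p.2 / 2))
  have hmeas := measurable_generator_split d hg
  have hh : Measurable h := (hf.comp measurable_fst).mul hmeas
  have h1 : ∀ y : Fin (d + 1) → ℝ, f (y 0) * ENNReal.ofReal (g (y ⬝ᵥ y / 2)) = h (e y) := by
    intro y
    have : y ⬝ᵥ y / 2 = (e y).1 ^ 2 / 2 + (e y).2 ⬝ᵥ (e y).2 / 2 := by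
      simp only [dotProduct, Fin.sum_univ_succ, e, MeasurableEquiv.piFinSuccAbove_apply,
        Fin.insertNthEquiv_symm_apply, Fin.removeNth, Fin.zero_succAbove]
      ring
    simp only [h, ← this]
    rfl
  simp_rw [h1]
  rw [hmp.lintegral_comp hh, Measure.volume_eq_prod, lintegral_prod _ hh.aemeasurable]
  refine lintegral_congr fun t => ?_
  change ∫⁻ y : Fin d → ℝ, f t * _ = _
  exact lintegral_const_mul _ (hmeas.comp measurable_prodMk_left)

lemma lintegral_marginalDensity {m : ℕ} (hm : 0 < m) {g : ℝ → ℝ} (hg : Measurable g) :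
    ∫⁻ t, marginalDensity m g t = ∫⁻ x : Fin m → ℝ, ENNReal.ofReal (g (x ⬝ᵥ x / 2)) := by
  obtain ⟨d, rfl⟩ := Nat.exists_eq_add_one.mpr hm
  simpa using (lintegral_mul_marginalDensity (d := d) hg (f := fun _ => 1) measurable_const).symm

/-- Every normalized linear functional of an elliptical law has the standardized marginal law. -/
lemma map_ellipticalLaw {m : ℕ} (μ : Fin m → ℝ) {S : Matrix (Fin m) (Fin m) ℝ} (hS : S.PosDef)
    {g : ℝ → ℝ} (hg : IsGenerator m g) {a : Fin m → ℝ} (ha : a ≠ 0) :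
    (ellipticalLaw μ S g).map (fun s => a ⬝ᵥ (s - μ) / √(a ⬝ᵥ (S *ᵥ a))) = stdLaw m g := by
  obtain ⟨d, rfl⟩ : ∃ d, m = d + 1 := by
    cases m with
    | zero => exact (ha (Subsingleton.elim _ _)).elim
    | succ d => exact ⟨d, rfl⟩
  obtain ⟨B, hdet, hB, hB0⟩ := exists_whitening hS ha 0
  have hw : ∀ x, ellipticalWeight μ S g x =
      ENNReal.ofReal (g ((B *ᵥ (x - μ)) ⬝ᵥ (B *ᵥ (x - μ)) / 2)) := by
    intro x
    rw [ellipticalWeight, hB, ← Matrix.mulVec_mulVec, Matrix.dotProduct_mulVec,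
      Matrix.vecMul_transpose]
  set c : ℝ≥0∞ := ENNReal.ofReal |B.det⁻¹| with hc
  have hc0 : c ≠ 0 := by
    rw [hc, Ne, ENNReal.ofReal_eq_zero, not_le]
    exact abs_pos.mpr (inv_ne_zero hdet)
  have hct : c ≠ ∞ := ENNReal.ofReal_ne_top
  have hBm : Measurable fun x : Fin (d + 1) → ℝ => B *ᵥ x :=
    (Continuous.matrix_mulVec continuous_const continuous_id).measurable
  have hchange : ∀ F : (Fin (d + 1) → ℝ) → ℝ≥0∞, Measurable F →
      ∫⁻ x, F (B *ᵥ (x - μ)) = c * ∫⁻ y, F y := by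
    intro F hF
    rw [lintegral_sub_right_eq_self (fun x => F (B *ᵥ x)) μ]
    have := Real.map_matrix_volume_pi_eq_smul_volume_pi hdet
    have h2 : ∫⁻ y, F y ∂(Measure.map (Matrix.toLin' B) volume) = c * ∫⁻ y, F y := by
      rw [this, lintegral_smul_measure, smul_eq_mul]
    rw [← h2, lintegral_map hF]
    · rfl
    · exact hBm
  have hgm : Measurable fun y : Fin (d + 1) → ℝ => ENNReal.ofReal (g (y ⬝ᵥ y / 2)) :=
    (hg.1.comp ((measurable_dotProduct_self _).div_const 2)).ennreal_ofReal
  have hfun : ∀ s, a ⬝ᵥ (s - μ) / √(a ⬝ᵥ (S *ᵥ a)) = (B *ᵥ (s - μ)) 0 := fun s => (hB0 _).symm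
  have hproj : Measurable fun s : Fin (d + 1) → ℝ => (B *ᵥ (s - μ)) 0 :=
    (measurable_pi_apply 0).comp (hBm.comp (measurable_id.sub_const μ))
  simp_rw [hfun]
  have hZ : ∫⁻ x, ellipticalWeight μ S g x = c * ∫⁻ t, marginalDensity (d + 1) g t := by
    simp_rw [hw]
    rw [hchange _ hgm, lintegral_marginalDensity (Nat.succ_pos d) hg.1]
  ext T hT
  have hJ : ∫⁻ x in (fun s => (B *ᵥ (s - μ)) 0) ⁻¹' T, ellipticalWeight μ S g x =
      c * ∫⁻ t in T, marginalDensity (d + 1) g t := by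
    rw [← lintegral_indicator (hproj hT), ← lintegral_indicator hT]
    have h1 : ∀ x, ((fun s => (B *ᵥ (s - μ)) 0) ⁻¹' T).indicator (ellipticalWeight μ S g) x =
        (fun y : Fin (d + 1) → ℝ => T.indicator 1 (y 0) * ENNReal.ofReal (g (y ⬝ᵥ y / 2)))
          (B *ᵥ (x - μ)) := by
      intro x
      by_cases hx : (B *ᵥ (x - μ)) 0 ∈ T
      · simp [Set.indicator, hx, hw]
      · simp [Set.indicator, hx]
    have hTm : Measurable (T.indicator (1 : ℝ → ℝ≥0∞)) := measurable_one.indicator hT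
    simp_rw [h1]
    rw [hchange (fun y => T.indicator 1 (y 0) * ENNReal.ofReal (g (y ⬝ᵥ y / 2)))
      ((hTm.comp (measurable_pi_apply 0)).mul hgm), lintegral_mul_marginalDensity hg.1 hTm]
    congr 1
    refine lintegral_congr fun t => ?_
    by_cases ht : t ∈ T <;> simp [ht]
  rw [Measure.map_apply hproj hT, ellipticalLaw, stdLaw, Measure.smul_apply, Measure.smul_apply,
    withDensity_apply _ (hproj hT), withDensity_apply _ hT, hJ, hZ, smul_eq_mul, smul_eq_mul,
    ENNReal.mul_inv (Or.inl hc0) (Or.inl hct), mul_mul_mul_comm, ENNReal.inv_mul_cancel hc0 hct,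
    one_mul]

lemma isProbabilityMeasure_stdLaw {m : ℕ} (hm : 0 < m) {g : ℝ → ℝ} (hg : IsGenerator m g) :
    IsProbabilityMeasure (stdLaw m g) := by
  constructor
  rw [stdLaw, Measure.smul_apply, withDensity_apply _ MeasurableSet.univ, Measure.restrict_univ,
    smul_eq_mul, lintegral_marginalDensity hm hg.1]
  exact ENNReal.inv_mul_cancel hg.2.2.1 hg.2.2.2

lemma isProbabilityMeasure_ellipticalLaw {m : ℕ} (hm : 0 < m) (μ : Fin m → ℝ)
    {S : Matrix (Fin m) (Fin m) ℝ} (hS : S.PosDef) {g : ℝ → ℝ} (hg : IsGenerator m g) :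
    IsProbabilityMeasure (ellipticalLaw μ S g) := by
  have ha : (Pi.single ⟨0, hm⟩ 1 : Fin m → ℝ) ≠ 0 := by simp
  have := isProbabilityMeasure_stdLaw hm hg
  rw [← map_ellipticalLaw μ hS hg ha] at this
  exact Measure.isProbabilityMeasure_of_map
    (fun s => (Pi.single ⟨0, hm⟩ 1 : Fin m → ℝ) ⬝ᵥ (s - μ) /
      √((Pi.single ⟨0, hm⟩ 1 : Fin m → ℝ) ⬝ᵥ (S *ᵥ Pi.single ⟨0, hm⟩ 1)))

lemma nullSingletonClass_stdLaw (m : ℕ) (g : ℝ → ℝ) : NullSingletonClass (stdLaw m g) := by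
  constructor
  intro x
  rw [stdLaw, Measure.smul_apply, withDensity_absolutelyContinuous volume _ (by simp), smul_zero]

lemma stdLaw_Iic_zero {m : ℕ} (hm : 0 < m) {g : ℝ → ℝ} (hg : IsGenerator m g) :
    (stdLaw m g).real (Iic 0) = 1 / 2 := by
  have := isProbabilityMeasure_stdLaw hm hg
  have := nullSingletonClass_stdLaw m g
  have hsymm : stdLaw m g (Ici 0) = stdLaw m g (Iic 0) := by
    rw [stdLaw, Measure.smul_apply, Measure.smul_apply, withDensity_apply _ measurableSet_Ici,
      withDensity_apply _ measurableSet_Iic]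
    congr 1
    have hneg : MeasurePreserving (fun x : ℝ => -x) volume volume :=
      Measure.measurePreserving_neg volume
    have := hneg.setLIntegral_comp_preimage (s := Iic 0) measurableSet_Iic
      (measurable_marginalDensity m hg.1)
    rw [← this]
    simp [marginalDensity]
  have h1 : (stdLaw m g).real (Ici 0) = (stdLaw m g).real (Iic 0) := by
    simp [measureReal_def, hsymm]
  have h2 := probReal_add_probReal_compl (μ := stdLaw m g) (measurableSet_Iic (a := (0 : ℝ)))
  rw [compl_Iic, measureReal_congr Ioi_ae_eq_Ici, h1] at h2
  linarith

lemma normConst_eq {m : ℕ} (hm : 0 < m) {g : ℝ → ℝ} (hg : IsGenerator m g) :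
    normConst m g = ((∫⁻ t, marginalDensity m g t)⁻¹).toReal := by
  have hlt : ∫⁻ t, marginalDensity m g t ≠ ∞ := by
    rw [lintegral_marginalDensity hm hg.1]
    exact hg.2.2.2
  simp_rw [normConst, marginalGenerator_sq_div_two hg]
  rw [integral_toReal (measurable_marginalDensity m hg.1).aemeasurable
    (ae_lt_top (measurable_marginalDensity m hg.1) hlt), ENNReal.toReal_inv]

/-- The real density of the standardized law. -/
noncomputable def stdDensity (m : ℕ) (g : ℝ → ℝ) (t : ℝ) : ℝ :=
  normConst m g * marginalGenerator m g (t ^ 2 / 2)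

/-- The standardized law has the density `k * marginalGenerator m g (x² / 2)`. On the null set where
the inner integral diverges, `marginalGenerator` has the junk value `0`. -/
lemma stdLaw_eq_withDensity {m : ℕ} (hm : 0 < m) {g : ℝ → ℝ} (hg : IsGenerator m g) :
    stdLaw m g = volume.withDensity
      (fun t => ENNReal.ofReal (stdDensity m g t)) := by
  have h0 : ∫⁻ t, marginalDensity m g t ≠ 0 := by
    rw [lintegral_marginalDensity hm hg.1]
    exact hg.2.2.1
  have hlt : ∫⁻ t, marginalDensity m g t ≠ ∞ := by
    rw [lintegral_marginalDensity hm hg.1]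
    exact hg.2.2.2
  rw [stdLaw, ← withDensity_smul _ (measurable_marginalDensity m hg.1)]
  refine withDensity_congr_ae ?_
  filter_upwards [ae_lt_top (measurable_marginalDensity m hg.1) hlt] with t ht
  rw [stdDensity, normConst_eq hm hg, marginalGenerator_sq_div_two hg,
    ENNReal.ofReal_mul ENNReal.toReal_nonneg, ENNReal.ofReal_toReal ht.ne,
    ENNReal.ofReal_toReal (ENNReal.inv_ne_top.mpr h0)]
  rfl

lemma stdDensity_nonneg {m : ℕ} (hm : 0 < m) {g : ℝ → ℝ} (hg : IsGenerator m g) (t : ℝ) :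
    0 ≤ stdDensity m g t := by
  rw [stdDensity, normConst_eq hm hg, marginalGenerator_sq_div_two hg]
  positivity

lemma measurable_stdDensity {m : ℕ} {g : ℝ → ℝ} (hg : IsGenerator m g) :
    Measurable (stdDensity m g) := by
  unfold stdDensity
  simp_rw [marginalGenerator_sq_div_two hg]
  exact (measurable_marginalDensity m hg.1).ennreal_toReal.const_mul _

lemma stdCDF_eq {m : ℕ} (hm : 0 < m) {g : ℝ → ℝ} (hg : IsGenerator m g) (x : ℝ) :
    stdCDF m g x = (stdLaw m g).real (Iic x) := by
  rw [stdLaw_eq_withDensity hm hg, measureReal_def, withDensity_apply _ measurableSet_Iic, stdCDF]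
  exact integral_eq_lintegral_of_nonneg_ae
    (Filter.Eventually.of_forall (stdDensity_nonneg hm hg))
    (measurable_stdDensity hg).aestronglyMeasurable

/-! ### Partial first moments and integrated distribution functions -/

lemma measure_Ioc_eq_ofReal (ρ : Measure ℝ) [IsProbabilityMeasure ρ] {t s : ℝ} (hts : t ≤ s) :
    ρ (Ioc t s) = ENNReal.ofReal (ρ.real (Iic s) - ρ.real (Iic t)) := by
  have h : Ioc t s = Iic s \ Iic t := by
    ext y
    simp [and_comm]
  rw [h, ← measureReal_sdiff (Iic_subset_Iic.mpr hts) measurableSet_Iic,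
    ofReal_measureReal]

lemma monotone_measureReal_Iic (ρ : Measure ℝ) [IsProbabilityMeasure ρ] :
    Monotone fun s => ρ.real (Iic s) :=
  fun _ _ h => measureReal_mono (Iic_subset_Iic.mpr h)

/-- The cost of moving the mass of `ρ` on `(t, η]` to the point `η`. -/
lemma setLIntegral_Ioc_sub (ρ : Measure ℝ) [IsProbabilityMeasure ρ] {t η : ℝ} (h : t ≤ η) :
    ∫⁻ y in Ioc t η, ENNReal.ofReal (η - y) ∂ρ =
      ENNReal.ofReal (∫ s in t..η, (ρ.real (Iic s) - ρ.real (Iic t))) := by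
  have hmono := monotone_measureReal_Iic ρ
  have hI : IntervalIntegrable (fun s => ρ.real (Iic s) - ρ.real (Iic t)) volume t η :=
    hmono.intervalIntegrable.sub intervalIntegrable_const
  have hK : Measurable (Function.uncurry fun y s : ℝ => (Ici y).indicator (1 : ℝ → ℝ≥0∞) s) := by
    have : (Function.uncurry fun y s : ℝ => (Ici y).indicator (1 : ℝ → ℝ≥0∞) s) =
        {p : ℝ × ℝ | p.1 ≤ p.2}.indicator 1 := by
      ext p
      simp [Function.uncurry, Set.indicator]
    rw [this]
    exact measurable_one.indicator (measurableSet_le measurable_fst measurable_snd)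
  calc ∫⁻ y in Ioc t η, ENNReal.ofReal (η - y) ∂ρ
      = ∫⁻ y in Ioc t η, ∫⁻ s in Ioc t η, (Ici y).indicator (1 : ℝ → ℝ≥0∞) s ∂volume ∂ρ := by
        refine setLIntegral_congr_fun measurableSet_Ioc fun y hy => ?_
        rw [lintegral_indicator_one measurableSet_Ici, Measure.restrict_apply measurableSet_Ici]
        have : Ici y ∩ Ioc t η = Icc y η := by
          ext s
          simp only [mem_inter_iff, mem_Ici, mem_Ioc, mem_Icc]
          exact ⟨fun hs => ⟨hs.1, hs.2.2⟩, fun hs => ⟨hs.1, hy.1.trans_le hs.1, hs.2⟩⟩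
        rw [this, Real.volume_Icc]
    _ = ∫⁻ s in Ioc t η, ∫⁻ y in Ioc t η, (Ici y).indicator (1 : ℝ → ℝ≥0∞) s ∂ρ ∂volume :=
        lintegral_lintegral_swap hK.aemeasurable
    _ = ∫⁻ s in Ioc t η, ENNReal.ofReal (ρ.real (Iic s) - ρ.real (Iic t)) := by
        refine setLIntegral_congr_fun measurableSet_Ioc fun s hs => ?_
        have h1 : ∀ y, (Ici y).indicator (1 : ℝ → ℝ≥0∞) s = (Iic s).indicator 1 y := by
          intro y
          simp [Set.indicator]
        simp only [h1]
        rw [lintegral_indicator_one measurableSet_Iic, Measure.restrict_apply measurableSet_Iic]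
        have : Iic s ∩ Ioc t η = Ioc t s := by
          ext y
          simp only [mem_inter_iff, mem_Iic, mem_Ioc]
          exact ⟨fun hy => ⟨hy.2.1, hy.1⟩, fun hy => ⟨hy.2, hy.1, hy.2.trans hs.2⟩⟩
        rw [this, measure_Ioc_eq_ofReal ρ hs.1.le]
    _ = ENNReal.ofReal (∫ s in t..η, (ρ.real (Iic s) - ρ.real (Iic t))) := by
        rw [intervalIntegral.integral_of_le h]
        refine (ofReal_integral_eq_lintegral_ofReal ?_ ?_).symm
        · exact (intervalIntegrable_iff_integrableOn_Ioc_of_le h).mp hI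
        · filter_upwards [ae_restrict_mem measurableSet_Ioc] with s hs
          exact sub_nonneg.mpr (hmono hs.1.le)

lemma integrable_stdDensity {m : ℕ} (hm : 0 < m) {g : ℝ → ℝ} (hg : IsGenerator m g) :
    Integrable (stdDensity m g) := by
  refine ⟨(measurable_stdDensity hg).aestronglyMeasurable, ?_⟩
  rw [hasFiniteIntegral_iff_ofReal (Filter.Eventually.of_forall (stdDensity_nonneg hm hg))]
  have := isProbabilityMeasure_stdLaw hm hg
  have h := measure_univ (μ := stdLaw m g)
  rw [stdLaw_eq_withDensity hm hg, withDensity_apply _ MeasurableSet.univ,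
    Measure.restrict_univ] at h
  exact h.trans_lt ENNReal.one_lt_top

lemma stdCDF_sub_stdCDF {m : ℕ} (hm : 0 < m) {g : ℝ → ℝ} (hg : IsGenerator m g) (a b : ℝ) :
    stdCDF m g b - stdCDF m g a = ∫ t in a..b, stdDensity m g t :=
  intervalIntegral.integral_Iic_sub_Iic (integrable_stdDensity hm hg).integrableOn
    (integrable_stdDensity hm hg).integrableOn

lemma continuous_stdCDF {m : ℕ} (hm : 0 < m) {g : ℝ → ℝ} (hg : IsGenerator m g) :
    Continuous (stdCDF m g) := by
  have h : stdCDF m g = fun x => stdCDF m g 0 + ∫ t in (0 : ℝ)..x, stdDensity m g t := by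
    ext x
    rw [← stdCDF_sub_stdCDF hm hg]
    ring
  rw [h]
  exact continuous_const.add (intervalIntegral.continuous_primitive
    (fun a b => (integrable_stdDensity hm hg).intervalIntegrable) 0)

lemma image_sq_div_two_Ioc {q η : ℝ} (hq : 0 ≤ q) (h : q ≤ η) :
    (fun y : ℝ => y ^ 2 / 2) '' Ioc q η = Ioc (q ^ 2 / 2) (η ^ 2 / 2) := by
  ext z
  constructor
  · rintro ⟨y, hy, rfl⟩
    have h1 := hy.1
    have h2 := hy.2
    constructor <;> dsimp only <;> nlinarith
  · intro hz
    have hz0 : 0 ≤ 2 * z := by nlinarith [hz.1, sq_nonneg q]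
    refine ⟨√(2 * z), ⟨Real.lt_sqrt_of_sq_lt (by linarith [hz.1]),
      Real.sqrt_le_iff.mpr ⟨hq.trans h, by linarith [hz.2]⟩⟩, ?_⟩
    simp only [Real.sq_sqrt hz0]
    ring

/-- The substitution `z = y² / 2` turns `κ` into a partial first moment of the standardized law. -/
lemma integral_marginalGenerator_eq {m : ℕ} {g : ℝ → ℝ} {q η : ℝ} (hq : 0 ≤ q) (h : q ≤ η) :
    ∫ z in (q ^ 2 / 2)..(η ^ 2 / 2), normConst m g * marginalGenerator m g z =
      ∫ y in Ioc q η, y * stdDensity m g y := by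
  have hle : q ^ 2 / 2 ≤ η ^ 2 / 2 := by nlinarith
  rw [intervalIntegral.integral_of_le hle, ← image_sq_div_two_Ioc hq h,
    integral_image_eq_integral_abs_deriv_smul (f' := fun y => y) measurableSet_Ioc]
  · refine setIntegral_congr_fun measurableSet_Ioc fun y hy => ?_
    simp only [smul_eq_mul, stdDensity, abs_of_pos (hq.trans_lt hy.1)]
  · intro y _
    exact (((hasDerivAt_pow 2 y).div_const 2).congr_deriv (by norm_num)).hasDerivWithinAt
  · intro x hx y hy hxy
    have hx0 := hq.trans_lt hx.1
    have hy0 := hq.trans_lt hy.1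
    have : x ^ 2 = y ^ 2 := by linarith
    exact (sq_eq_sq₀ hx0.le hy0.le).mp this

/-- Integration by parts for the distribution function of the standardized law, whose density need
not be continuous. -/
lemma mul_stdCDF_sub_integral {m : ℕ} (hm : 0 < m) {g : ℝ → ℝ} (hg : IsGenerator m g) {q η : ℝ}
    (h : q ≤ η) :
    η * (stdCDF m g η - stdCDF m g q) - ∫ y in Ioc q η, y * stdDensity m g y =
      ∫ s in q..η, (stdCDF m g s - stdCDF m g q) := by
  have := isProbabilityMeasure_stdLaw hm hg
  have hφ := integrable_stdDensity hm hg
  have hI1 : IntegrableOn (fun y => η * stdDensity m g y) (Ioc q η) :=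
    (hφ.const_mul η).integrableOn
  have hI2 : IntegrableOn (fun y => y * stdDensity m g y) (Ioc q η) :=
    ((hφ.intervalIntegrable (a := q) (b := η)).continuousOn_mul continuousOn_id).1
  rw [stdCDF_sub_stdCDF hm hg, intervalIntegral.integral_of_le h, ← integral_const_mul,
    ← integral_sub hI1 hI2]
  have hpos : ∀ y ∈ Ioc q η, 0 ≤ η * stdDensity m g y - y * stdDensity m g y := by
    intro y hy
    rw [← sub_mul]
    exact mul_nonneg (sub_nonneg.mpr hy.2) (stdDensity_nonneg hm hg y)
  rw [integral_eq_lintegral_of_nonneg_ae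
    (f := fun y => η * stdDensity m g y - y * stdDensity m g y)
    (by filter_upwards [ae_restrict_mem measurableSet_Ioc] with y hy using hpos y hy)
    (hI1.sub hI2).aestronglyMeasurable]
  have h1 : ∫⁻ y in Ioc q η, ENNReal.ofReal (η * stdDensity m g y - y * stdDensity m g y) =
      ∫⁻ y in Ioc q η, ENNReal.ofReal (η - y) ∂(stdLaw m g) := by
    rw [stdLaw_eq_withDensity hm hg,
      setLIntegral_withDensity_eq_setLIntegral_mul _ (measurable_stdDensity hg).ennreal_ofReal
        (g := fun y => ENNReal.ofReal (η - y)) (by fun_prop) measurableSet_Ioc]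
    refine lintegral_congr fun y => ?_
    rw [← sub_mul, mul_comm, ENNReal.ofReal_mul (stdDensity_nonneg hm hg y)]
    rfl
  rw [h1, setLIntegral_Ioc_sub _ h]
  simp_rw [stdCDF_eq hm hg]
  refine ENNReal.toReal_ofReal (intervalIntegral.integral_nonneg h fun s hs => ?_)
  exact sub_nonneg.mpr (monotone_measureReal_Iic _ hs.1)

/-! ### The tightened quantile -/

namespace Ambiguity

open Filter Topology

variable {m : ℕ} (A : Ambiguity m)

lemma Φ_eq (hm : 0 < m) (x : ℝ) : A.Φ x = (stdLaw m A.g).real (Iic x) :=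
  stdCDF_eq hm A.isGenerator x

lemma continuous_Φ (hm : 0 < m) : Continuous A.Φ := continuous_stdCDF hm A.isGenerator

lemma monotone_Φ (hm : 0 < m) : Monotone A.Φ := by
  have := isProbabilityMeasure_stdLaw hm A.isGenerator
  intro x y h
  simp only [A.Φ_eq hm]
  exact monotone_measureReal_Iic _ h

lemma tendsto_Φ_atTop (hm : 0 < m) : Tendsto A.Φ atTop (𝓝 1) := by
  have := isProbabilityMeasure_stdLaw hm A.isGenerator
  have h := ProbabilityTheory.tendsto_cdf_atTop (stdLaw m A.g)
  refine h.congr fun x => ?_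
  rw [A.Φ_eq hm, ProbabilityTheory.cdf_eq_real]

lemma tendsto_Φ_atBot (hm : 0 < m) : Tendsto A.Φ atBot (𝓝 0) := by
  have := isProbabilityMeasure_stdLaw hm A.isGenerator
  have h := ProbabilityTheory.tendsto_cdf_atBot (stdLaw m A.g)
  refine h.congr fun x => ?_
  rw [A.Φ_eq hm, ProbabilityTheory.cdf_eq_real]

lemma isLeast_Φinv (hm : 0 < m) {p : ℝ} (h0 : 0 < p) (h1 : p < 1) :
    IsLeast {x | p ≤ A.Φ x} (A.Φinv p) := by
  have hne : {x | p ≤ A.Φ x}.Nonempty := by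
    obtain ⟨x, hx⟩ := ((A.tendsto_Φ_atTop hm).eventually (lt_mem_nhds h1)).exists
    exact ⟨x, hx.le⟩
  have hbdd : BddBelow {x | p ≤ A.Φ x} := by
    obtain ⟨x, hx⟩ := ((A.tendsto_Φ_atBot hm).eventually (gt_mem_nhds h0)).exists
    refine ⟨x, fun y hy => ?_⟩
    by_contra hxy
    exact absurd (A.monotone_Φ hm (not_le.mp hxy).le) (not_le.mpr (hx.trans_le hy))
  exact (isClosed_le continuous_const (A.continuous_Φ hm)).isLeast_csInf hne hbdd

lemma Φ_lt_of_lt_Φinv (hm : 0 < m) {p x : ℝ} (h0 : 0 < p) (h1 : p < 1) (hx : x < A.Φinv p) :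
    A.Φ x < p := by
  by_contra h
  exact absurd ((A.isLeast_Φinv hm h0 h1).2 (not_lt.mp h)) (not_le.mpr hx)

lemma Φ_Φinv (hm : 0 < m) {p : ℝ} (h0 : 0 < p) (h1 : p < 1) : A.Φ (A.Φinv p) = p := by
  refine le_antisymm ?_ (A.isLeast_Φinv hm h0 h1).1
  refine le_of_tendsto (b := p) (x := 𝓝[<] A.Φinv p)
    (((A.continuous_Φ hm).tendsto (A.Φinv p)).mono_left nhdsWithin_le_nhds)
    (eventually_mem_nhdsWithin.mono fun x hx => (A.Φ_lt_of_lt_Φinv hm h0 h1 hx).le)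

/-- The reference quantile `Φ⁻¹(1 - ε)`. -/
noncomputable def refQuantile : ℝ := A.Φinv (1 - A.ε)

lemma Φ_refQuantile (hm : 0 < m) : A.Φ A.refQuantile = 1 - A.ε :=
  A.Φ_Φinv hm (by linarith [A.ε_lt]) (by linarith [A.ε_pos])

lemma Φ_lt_of_lt_refQuantile (hm : 0 < m) {x : ℝ} (hx : x < A.refQuantile) : A.Φ x < 1 - A.ε :=
  A.Φ_lt_of_lt_Φinv hm (by linarith [A.ε_lt]) (by linarith [A.ε_pos]) hx

lemma refQuantile_pos (hm : 0 < m) : 0 < A.refQuantile := by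
  by_contra h
  have h1 := A.monotone_Φ hm (not_lt.mp h)
  rw [A.Φ_refQuantile hm, A.Φ_eq hm 0, stdLaw_Iic_zero hm A.isGenerator] at h1
  linarith [A.ε_lt]

/-- For `η` above the reference quantile, the least transport cost that raises the probability of
exceeding `η` to `ε`. -/
noncomputable def transportCost (η : ℝ) : ℝ := ∫ s in A.refQuantile..η, (A.Φ s - (1 - A.ε))

lemma mul_Φ_sub_kappa (hm : 0 < m) {η : ℝ} (h : A.refQuantile ≤ η) :
    η * (A.Φ η - (1 - A.ε)) - A.kappa η = A.transportCost η := by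
  have h1 := mul_stdCDF_sub_integral hm A.isGenerator h
  rw [← integral_marginalGenerator_eq (A.refQuantile_pos hm).le h] at h1
  rw [transportCost, ← A.Φ_refQuantile hm]
  exact h1

lemma etaFeasible_eq (hm : 0 < m) :
    A.etaFeasible = {η | A.refQuantile ≤ η ∧ A.θ ≤ A.transportCost η} := by
  ext η
  refine and_congr_right fun h => ?_
  rw [A.mul_Φ_sub_kappa hm h]

lemma intervalIntegrable_Φ_sub (hm : 0 < m) (c a b : ℝ) :
    IntervalIntegrable (fun s => A.Φ s - c) volume a b :=
  ((A.continuous_Φ hm).sub continuous_const).intervalIntegrable a b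

lemma continuous_transportCost (hm : 0 < m) : Continuous A.transportCost :=
  intervalIntegral.continuous_primitive (fun a b => A.intervalIntegrable_Φ_sub hm _ a b) _

lemma transportCost_add_le (hm : 0 < m) {η η' : ℝ} (h : η ≤ η') :
    A.transportCost η + (η' - η) * (A.Φ η - (1 - A.ε)) ≤ A.transportCost η' := by
  have h1 := intervalIntegral.integral_add_adjacent_intervals
    (A.intervalIntegrable_Φ_sub hm (1 - A.ε) A.refQuantile η)
    (A.intervalIntegrable_Φ_sub hm (1 - A.ε) η η')
  have h2 : ∫ _ in η..η', (A.Φ η - (1 - A.ε)) ≤ ∫ s in η..η', (A.Φ s - (1 - A.ε)) :=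
    intervalIntegral.integral_mono_on h intervalIntegrable_const
      (A.intervalIntegrable_Φ_sub hm _ _ _) fun s hs =>
        sub_le_sub_right (A.monotone_Φ hm hs.1) _
  rw [intervalIntegral.integral_const, smul_eq_mul] at h2
  unfold transportCost
  linarith

lemma transportCost_mono (hm : 0 < m) {η η' : ℝ} (hq : A.refQuantile ≤ η) (h : η ≤ η') :
    A.transportCost η ≤ A.transportCost η' := by
  have h1 := A.transportCost_add_le hm h
  have h2 := A.monotone_Φ hm hq
  rw [A.Φ_refQuantile hm] at h2
  nlinarith [mul_nonneg (sub_nonneg.mpr h) (sub_nonneg.mpr h2)]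

/-- The transport cost grows at least linearly where `Φ` is above `1 - ε / 2`, so the constraint
`θ ≤ transportCost η` is eventually met. -/
lemma isLeast_etaStar (hm : 0 < m) : IsLeast A.etaFeasible A.etaStar := by
  have hε := A.ε_pos
  have hθ := A.θ_nonneg
  have hne : A.etaFeasible.Nonempty := by
    obtain ⟨η, hη, hqη⟩ := (((A.tendsto_Φ_atTop hm).eventually
      (lt_mem_nhds (by linarith : 1 - A.ε / 2 < 1))).and (eventually_ge_atTop A.refQuantile)).exists
    have h0 : A.transportCost A.refQuantile = 0 := intervalIntegral.integral_same
    have h1 := A.transportCost_mono hm le_rfl hqη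
    have hd : 0 ≤ 2 * A.θ / A.ε := by positivity
    have h2 := A.transportCost_add_le hm (show η ≤ η + 2 * A.θ / A.ε by linarith)
    have h3 : A.θ ≤ (η + 2 * A.θ / A.ε - η) * (A.Φ η - (1 - A.ε)) := by
      calc A.θ = (2 * A.θ / A.ε) * (A.ε / 2) := by field_simp
        _ ≤ (2 * A.θ / A.ε) * (A.Φ η - (1 - A.ε)) :=
            mul_le_mul_of_nonneg_left (by linarith) hd
        _ = _ := by ring
    rw [A.etaFeasible_eq hm]
    exact ⟨η + 2 * A.θ / A.ε, by linarith, by linarith⟩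
  have hcl : IsClosed A.etaFeasible := by
    rw [A.etaFeasible_eq hm]
    exact (isClosed_le continuous_const continuous_id).inter
      (isClosed_le continuous_const (A.continuous_transportCost hm))
  exact hcl.isLeast_csInf hne ⟨A.refQuantile, fun η hη => hη.1⟩

lemma mem_etaFeasible_iff (hm : 0 < m) (η : ℝ) : η ∈ A.etaFeasible ↔ A.etaStar ≤ η := by
  refine ⟨fun h => (A.isLeast_etaStar hm).2 h, fun h => ?_⟩
  have h1 := (A.isLeast_etaStar hm).1
  rw [A.etaFeasible_eq hm] at h1 ⊢
  exact ⟨h1.1.trans h, h1.2.trans (A.transportCost_mono hm h1.1 h)⟩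

lemma one_sub_ε_le_Φ_etaStar (hm : 0 < m) : 1 - A.ε ≤ A.Φ A.etaStar := by
  rw [← A.Φ_refQuantile hm]
  exact A.monotone_Φ hm (A.isLeast_etaStar hm).1.1

lemma epsLow_le (hm : 0 < m) : A.epsLow ≤ A.ε := by
  have := A.one_sub_ε_le_Φ_etaStar hm
  unfold epsLow
  linarith

/-- Strict monotonicity of `Φ` excludes a flat piece of `Φ` to the left of `etaStar`, which would give
`<`. -/
lemma Φinv_one_sub_epsLow (hm : 0 < m) (hA : A.Invertible) : A.Φinv (1 - A.epsLow) = A.etaStar := by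
  have h0 : 0 < A.Φ A.etaStar := by linarith [A.one_sub_ε_le_Φ_etaStar hm, A.ε_lt]
  have h1 : A.Φ A.etaStar < 1 := sub_pos.mp hA.2
  rw [epsLow, sub_sub_cancel]
  have hq := A.isLeast_Φinv hm h0 h1
  refine le_antisymm (hq.2 (show A.Φ A.etaStar ≤ A.Φ A.etaStar from le_rfl)) (not_lt.mp fun hlt => ?_)
  have heq := A.Φ_Φinv hm h0 h1
  exact (hA.1 ⟨h0.trans_eq heq.symm, heq.trans_lt h1⟩ ⟨h0, h1⟩ hlt).ne heq

end Ambiguity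

/-! ### The worst case over a Wasserstein ball -/

lemma wasserstein_map_le {m : ℕ} (S : Matrix (Fin m) (Fin m) ℝ) (P : Measure (Fin m → ℝ))
    {T : (Fin m → ℝ) → Fin m → ℝ} (hT : Measurable T) :
    wasserstein S P (P.map T) ≤ ∫⁻ s, ENNReal.ofReal (mahalanobis S (s - T s)) ∂P := by
  have hG : Measurable fun s => (s, T s) := measurable_id.prodMk hT
  have hc : Measurable fun z : (Fin m → ℝ) × (Fin m → ℝ) =>
      ENNReal.ofReal (mahalanobis S (z.1 - z.2)) :=
    ((measurable_mahalanobis S).comp (measurable_fst.sub measurable_snd)).ennreal_ofReal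
  have hcoupling : IsCoupling P (P.map T) (P.map fun s => (s, T s)) := by
    constructor
    · rw [Measure.map_map measurable_fst hG]
      exact Measure.map_id
    · rw [Measure.map_map measurable_snd hG]
      rfl
  exact (iInf₂_le _ hcoupling).trans_eq (lintegral_map hc hG)

namespace Ambiguity

open Filter Topology

variable {m : ℕ} (A : Ambiguity m)

/-- The functional `a`, standardized under the reference law. -/
noncomputable def score (a s : Fin m → ℝ) : ℝ := a ⬝ᵥ (s - A.mean) / √(a ⬝ᵥ (A.Sigma *ᵥ a))

lemma measurable_score (a : Fin m → ℝ) : Measurable (A.score a) := by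
  unfold score
  exact ((Continuous.dotProduct continuous_const
    (continuous_id.sub continuous_const)).div_const _).measurable

lemma map_score_refLaw {a : Fin m → ℝ} (ha : a ≠ 0) :
    A.refLaw.map (A.score a) = stdLaw m A.g :=
  map_ellipticalLaw A.mean A.sigma_posDef A.isGenerator ha

lemma isProbabilityMeasure_refLaw (hm : 0 < m) : IsProbabilityMeasure A.refLaw :=
  isProbabilityMeasure_ellipticalLaw hm A.mean A.sigma_posDef A.isGenerator

lemma sqrt_dotProduct_pos {a : Fin m → ℝ} (ha : a ≠ 0) : 0 < √(a ⬝ᵥ (A.Sigma *ᵥ a)) :=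
  Real.sqrt_pos.mpr (dotProduct_mulVec_pos_of_posDef A.sigma_posDef ha)

lemma abs_score_sub_score_le {a : Fin m → ℝ} (ha : a ≠ 0) (s s' : Fin m → ℝ) :
    |A.score a s - A.score a s'| ≤ mahalanobis A.Sigma (s - s') := by
  have h := abs_dotProduct_div_le_mahalanobis A.sigma_posDef ha (s - s')
  rwa [← sub_sub_sub_cancel_right s s' A.mean, dotProduct_sub, sub_div,
    sub_sub_sub_cancel_right] at h

/-- Raising the score by `r` costs `|r|` along the direction `Sigma a`. -/
lemma score_add_smul {a : Fin m → ℝ} (ha : a ≠ 0) (s : Fin m → ℝ) (r : ℝ) :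
    A.score a (s + (r / √(a ⬝ᵥ (A.Sigma *ᵥ a))) • (A.Sigma *ᵥ a)) = A.score a s + r := by
  have h0 := A.sqrt_dotProduct_pos ha
  have hsq := Real.sq_sqrt (dotProduct_mulVec_pos_of_posDef A.sigma_posDef ha).le
  rw [score, score, add_sub_right_comm, dotProduct_add, dotProduct_smul, smul_eq_mul]
  nth_rewrite 2 [← hsq]
  field_simp

lemma Φ_le_one (hm : 0 < m) (x : ℝ) : A.Φ x ≤ 1 := by
  have := isProbabilityMeasure_stdLaw hm A.isGenerator
  rw [A.Φ_eq hm]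
  exact measureReal_le_one

/-- The dual bound behind the worst case: charging `η - t` for each unit of mass that ends above
`η`, and crediting `η - t` for mass that started above `t`. -/
lemma le_transport_integrand {t η y y' c : ℝ} (htη : t ≤ η) (hc : |y - y'| ≤ c) :
    (Ioi η).indicator (fun _ => ENNReal.ofReal (η - t)) y' +
        (Ioc t η).indicator (fun u => ENNReal.ofReal (η - u)) y ≤
      ENNReal.ofReal c + (Ioi t).indicator (fun _ => ENNReal.ofReal (η - t)) y := by
  have hc' := (abs_le.mp hc).1
  have hc0 : 0 ≤ c := (abs_nonneg _).trans hc
  by_cases h1 : η < y' <;> by_cases h2 : t < y <;> by_cases h3 : y ≤ η <;>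
    simp only [Set.indicator, mem_Ioi, mem_Ioc, h1, h2, h3, and_self, and_true, and_false,
      if_true, if_false, add_zero, zero_add, zero_le]
  · rw [add_comm]
    exact add_le_add_left (ENNReal.ofReal_le_ofReal (by linarith)) _
  · exact le_add_self
  · exact ENNReal.ofReal_le_ofReal (by linarith)
  · exact absurd (not_lt.mp h2) (by linarith [not_le.mp h3])
  · exact (ENNReal.ofReal_le_ofReal (by linarith)).trans le_add_self

lemma integral_le_wasserstein (hm : 0 < m) {a : Fin m → ℝ} (ha : a ≠ 0)
    {P : Measure (Fin m → ℝ)} [IsProbabilityMeasure P] {t η : ℝ} (htη : t ≤ η) :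
    ENNReal.ofReal (∫ s in t..η, (A.Φ s - (1 - P.real {s | η < A.score a s}))) ≤
      wasserstein A.Sigma A.refLaw P := by
  have := isProbabilityMeasure_stdLaw hm A.isGenerator
  refine le_iInf₂ fun π hπ => ?_
  set p := P.real {s | η < A.score a s} with hp
  have hY := A.measurable_score a
  have hY1 : Measurable fun z : (Fin m → ℝ) × (Fin m → ℝ) => A.score a z.1 :=
    hY.comp measurable_fst
  have hY2 : Measurable fun z : (Fin m → ℝ) × (Fin m → ℝ) => A.score a z.2 :=
    hY.comp measurable_snd
  have hfst : ∀ f : ℝ → ℝ≥0∞, Measurable f →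
      ∫⁻ z, f (A.score a z.1) ∂π = ∫⁻ y, f y ∂(stdLaw m A.g) := by
    intro f hf
    rw [← A.map_score_refLaw ha, lintegral_map hf hY, ← hπ.1,
      lintegral_map (f := fun s => f (A.score a s)) (hf.comp hY) measurable_fst]
  have hsnd : ∀ f : ℝ → ℝ≥0∞, Measurable f →
      ∫⁻ z, f (A.score a z.2) ∂π = ∫⁻ s, f (A.score a s) ∂P := by
    intro f hf
    rw [← hπ.2, lintegral_map (f := fun s => f (A.score a s)) (hf.comp hY) measurable_snd]
  have hf1 : Measurable ((Ioi η).indicator fun _ : ℝ => ENNReal.ofReal (η - t)) :=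
    measurable_const.indicator measurableSet_Ioi
  have hf2 : Measurable ((Ioc t η).indicator fun u : ℝ => ENNReal.ofReal (η - u)) :=
    Measurable.indicator (by fun_prop) measurableSet_Ioc
  have hf3 : Measurable ((Ioi t).indicator fun _ : ℝ => ENNReal.ofReal (η - t)) :=
    measurable_const.indicator measurableSet_Ioi
  have key := lintegral_mono (μ := π) fun z =>
    le_transport_integrand htη (A.abs_score_sub_score_le ha z.1 z.2)
  have hg1 : Measurable fun z : (Fin m → ℝ) × (Fin m → ℝ) =>
      (Ioi η).indicator (fun _ => ENNReal.ofReal (η - t)) (A.score a z.2) := hf1.comp hY2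
  have hg3 : Measurable fun z : (Fin m → ℝ) × (Fin m → ℝ) =>
      (Ioi t).indicator (fun _ => ENNReal.ofReal (η - t)) (A.score a z.1) := hf3.comp hY1
  rw [lintegral_add_left hg1, lintegral_add_right _ hg3,
    hfst _ hf2, hfst _ hf3, hsnd _ hf1, lintegral_indicator measurableSet_Ioc,
    setLIntegral_Ioc_sub _ htη, lintegral_indicator_const measurableSet_Ioi] at key
  have h1 : ∫⁻ s, (Ioi η).indicator (fun _ => ENNReal.ofReal (η - t)) (A.score a s) ∂P =
      ENNReal.ofReal ((η - t) * p) := by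
    have : ∀ s, (Ioi η).indicator (fun _ => ENNReal.ofReal (η - t)) (A.score a s) =
        {s | η < A.score a s}.indicator (fun _ => ENNReal.ofReal (η - t)) s := fun s => rfl
    simp_rw [this]
    rw [lintegral_indicator_const (measurableSet_lt measurable_const hY),
      ENNReal.ofReal_mul (sub_nonneg.mpr htη), hp, ofReal_measureReal]
  have h2 : stdLaw m A.g (Ioi t) = ENNReal.ofReal (1 - A.Φ t) := by
    rw [← compl_Iic, ← ofReal_measureReal, probReal_compl_eq_one_sub measurableSet_Iic, A.Φ_eq hm]
  simp_rw [← A.Φ_eq hm] at key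
  rw [h1, h2, ← ENNReal.ofReal_mul (sub_nonneg.mpr htη)] at key
  have hI : 0 ≤ ∫ s in t..η, (A.Φ s - A.Φ t) :=
    intervalIntegral.integral_nonneg htη fun s hs => sub_nonneg.mpr (A.monotone_Φ hm hs.1)
  have hp0 : 0 ≤ (η - t) * p := mul_nonneg (sub_nonneg.mpr htη) measureReal_nonneg
  have hL : ∫ s in t..η, (A.Φ s - (1 - p)) =
      ((η - t) * p + ∫ s in t..η, (A.Φ s - A.Φ t)) - (η - t) * (1 - A.Φ t) := by
    have hΦ := (A.continuous_Φ hm).intervalIntegrable (μ := volume) t η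
    rw [intervalIntegral.integral_sub hΦ intervalIntegrable_const,
      intervalIntegral.integral_sub hΦ intervalIntegrable_const,
      intervalIntegral.integral_const, intervalIntegral.integral_const, smul_eq_mul, smul_eq_mul]
    ring
  rw [hL, ENNReal.ofReal_sub _
    (mul_nonneg (sub_nonneg.mpr htη) (sub_nonneg.mpr (A.Φ_le_one hm t))),
    tsub_le_iff_right, ENNReal.ofReal_add hp0 hI]
  exact key

/-- If the least transport cost reaches `θ`, no law in the ball violates the chance constraint. -/
lemma le_measure_of_mem_etaFeasible (hm : 0 < m) {a : Fin m → ℝ} (ha : a ≠ 0) {η : ℝ}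
    (hη : η ∈ A.etaFeasible) {P : Measure (Fin m → ℝ)} (hP : P ∈ A.ball) :
    ENNReal.ofReal (1 - A.ε) ≤ P {s | A.score a s ≤ η} := by
  have := hP.1
  rw [A.etaFeasible_eq hm] at hη
  obtain ⟨hqη, hθ⟩ := hη
  by_contra hlt
  set p := P.real {s | η < A.score a s} with hp
  have hpε : A.ε < p := by
    have h1 : P.real {s | A.score a s ≤ η} = 1 - p := by
      have := probReal_compl_eq_one_sub (μ := P)
        (measurableSet_lt (measurable_const (a := η)) (A.measurable_score a))
      rw [hp, ← this]
      congr 1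
      ext s
      simp
    rw [not_le, ← ofReal_measureReal, h1] at hlt
    have := ENNReal.ofReal_lt_ofReal_iff'.mp hlt
    linarith [this.1]
  -- A level `t` slightly below the quantile leaves room for a strict inequality, even when `η`
  -- equals the quantile.
  obtain ⟨t, hpt, htq⟩ : ∃ t, 1 - p < A.Φ t ∧ t < A.refQuantile := by
    have h1 : ∀ᶠ t in 𝓝[<] A.refQuantile, 1 - p < A.Φ t :=
      (((A.continuous_Φ hm).tendsto A.refQuantile).mono_left nhdsWithin_le_nhds).eventually
        (lt_mem_nhds (by rw [A.Φ_refQuantile hm]; linarith))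
    exact (h1.and eventually_mem_nhdsWithin).exists
  have hW := (A.integral_le_wasserstein hm ha (P := P) (htq.le.trans hqη)).trans hP.2
  rw [ENNReal.ofReal_le_ofReal_iff A.θ_nonneg] at hW
  have hsplit := intervalIntegral.integral_add_adjacent_intervals
    (A.intervalIntegrable_Φ_sub hm (1 - p) t A.refQuantile)
    (A.intervalIntegrable_Φ_sub hm (1 - p) A.refQuantile η)
  have h2 : ∫ _ in t..A.refQuantile, (A.Φ t - (1 - p)) ≤
      ∫ s in t..A.refQuantile, (A.Φ s - (1 - p)) :=
    intervalIntegral.integral_mono_on htq.le intervalIntegrable_const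
      (A.intervalIntegrable_Φ_sub hm _ _ _) fun s hs =>
        sub_le_sub_right (A.monotone_Φ hm hs.1) _
  have h3 : A.transportCost η ≤ ∫ s in A.refQuantile..η, (A.Φ s - (1 - p)) :=
    intervalIntegral.integral_mono_on hqη (A.intervalIntegrable_Φ_sub hm _ _ _)
      (A.intervalIntegrable_Φ_sub hm _ _ _) fun s _ => by linarith
  rw [intervalIntegral.integral_const, smul_eq_mul] at h2
  have h4 := mul_pos (sub_pos.mpr htq) (sub_pos.mpr hpt)
  linarith

/-- The transport that raises every score in `(t, η]` to the level `η + δ`. -/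
noncomputable def raise (a : Fin m → ℝ) (t η δ : ℝ) (s : Fin m → ℝ) : Fin m → ℝ :=
  s + ((Ioc t η).indicator (fun y => η + δ - y) (A.score a s) / √(a ⬝ᵥ (A.Sigma *ᵥ a))) •
    (A.Sigma *ᵥ a)

lemma measurable_raise (a : Fin m → ℝ) (t η δ : ℝ) : Measurable (A.raise a t η δ) := by
  have h : Measurable ((Ioc t η).indicator fun y : ℝ => η + δ - y) :=
    Measurable.indicator (by fun_prop) measurableSet_Ioc
  exact measurable_id.add (((h.comp (A.measurable_score a)).div_const _).smul_const _)

lemma mahalanobis_sub_raise {a : Fin m → ℝ} (ha : a ≠ 0) {t η δ : ℝ} (hδ : 0 ≤ δ)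
    (s : Fin m → ℝ) :
    mahalanobis A.Sigma (s - A.raise a t η δ s) =
      (Ioc t η).indicator (fun y => η + δ - y) (A.score a s) := by
  have h0 := A.sqrt_dotProduct_pos ha
  have hnn : 0 ≤ (Ioc t η).indicator (fun y => η + δ - y) (A.score a s) :=
    Set.indicator_apply_nonneg fun hy => by linarith [hy.2]
  rw [raise, sub_add_cancel_left, ← neg_smul, mahalanobis_smul_mulVec A.sigma_posDef, abs_neg,
    abs_of_nonneg (div_nonneg hnn h0.le), div_mul_cancel₀ _ h0.ne']

lemma score_raise_le_iff {a : Fin m → ℝ} (ha : a ≠ 0) {t η δ : ℝ} (htη : t ≤ η) (hδ : 0 < δ)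
    (s : Fin m → ℝ) : A.score a (A.raise a t η δ s) ≤ η ↔ A.score a s ≤ t := by
  rw [raise, A.score_add_smul ha]
  by_cases h : A.score a s ∈ Ioc t η
  · rw [Set.indicator_of_mem h]
    have := h.1
    constructor <;> intro h' <;> linarith
  · rw [Set.indicator_of_notMem h, add_zero]
    refine ⟨fun h' => not_lt.mp fun hlt => h ⟨hlt, h'⟩, fun h' => h'.trans htη⟩

lemma refLaw_score_le (hm : 0 < m) {a : Fin m → ℝ} (ha : a ≠ 0) (t : ℝ) :
    A.refLaw {s | A.score a s ≤ t} = ENNReal.ofReal (A.Φ t) := by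
  have := isProbabilityMeasure_stdLaw hm A.isGenerator
  rw [A.Φ_eq hm, ofReal_measureReal, ← A.map_score_refLaw ha,
    Measure.map_apply (A.measurable_score a) measurableSet_Iic]
  rfl

lemma lintegral_mahalanobis_sub_raise_le (hm : 0 < m) {a : Fin m → ℝ} (ha : a ≠ 0) {t η δ : ℝ}
    (htη : t ≤ η) (hδ : 0 ≤ δ) :
    ∫⁻ s, ENNReal.ofReal (mahalanobis A.Sigma (s - A.raise a t η δ s)) ∂A.refLaw ≤
      ENNReal.ofReal ((∫ s in t..η, (A.Φ s - A.Φ t)) + δ) := by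
  have := isProbabilityMeasure_stdLaw hm A.isGenerator
  have hI : 0 ≤ ∫ s in t..η, (A.Φ s - A.Φ t) :=
    intervalIntegral.integral_nonneg htη fun s hs => sub_nonneg.mpr (A.monotone_Φ hm hs.1)
  have hf : Measurable ((Ioc t η).indicator fun y : ℝ => ENNReal.ofReal (η + δ - y)) :=
    Measurable.indicator (by fun_prop) measurableSet_Ioc
  have h1 : ∀ s, ENNReal.ofReal (mahalanobis A.Sigma (s - A.raise a t η δ s)) =
      (Ioc t η).indicator (fun y : ℝ => ENNReal.ofReal (η + δ - y)) (A.score a s) := by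
    intro s
    rw [A.mahalanobis_sub_raise ha hδ]
    by_cases h : A.score a s ∈ Ioc t η <;> simp [h]
  simp_rw [h1]
  rw [← lintegral_map hf (A.measurable_score a), A.map_score_refLaw ha,
    lintegral_indicator measurableSet_Ioc]
  calc ∫⁻ y in Ioc t η, ENNReal.ofReal (η + δ - y) ∂(stdLaw m A.g)
      = ∫⁻ y in Ioc t η, (ENNReal.ofReal (η - y) + ENNReal.ofReal δ) ∂(stdLaw m A.g) := by
        refine setLIntegral_congr_fun measurableSet_Ioc fun y hy => ?_
        rw [← ENNReal.ofReal_add (sub_nonneg.mpr hy.2) hδ]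
        ring_nf
    _ = ENNReal.ofReal (∫ s in t..η, (A.Φ s - A.Φ t)) +
          ENNReal.ofReal δ * stdLaw m A.g (Ioc t η) := by
        rw [lintegral_add_right _ measurable_const, setLIntegral_const, setLIntegral_Ioc_sub _ htη]
        simp_rw [A.Φ_eq hm]
    _ ≤ ENNReal.ofReal (∫ s in t..η, (A.Φ s - A.Φ t)) + ENNReal.ofReal δ * 1 := by
        gcongr
        exact prob_le_one
    _ = ENNReal.ofReal ((∫ s in t..η, (A.Φ s - A.Φ t)) + δ) := by
        rw [mul_one, ENNReal.ofReal_add hI hδ]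

lemma map_raise_mem_ball (hm : 0 < m) {a : Fin m → ℝ} (ha : a ≠ 0) {t η δ : ℝ}
    (htη : t ≤ η) (hδ : 0 ≤ δ) (hθ : (∫ s in t..η, (A.Φ s - A.Φ t)) + δ ≤ A.θ) :
    A.refLaw.map (A.raise a t η δ) ∈ A.ball := by
  have := A.isProbabilityMeasure_refLaw hm
  have hT := A.measurable_raise a t η δ
  exact ⟨Measure.isProbabilityMeasure_map hT.aemeasurable, (wasserstein_map_le _ _ hT).trans
    ((A.lintegral_mahalanobis_sub_raise_le hm ha htη hδ).trans (ENNReal.ofReal_le_ofReal hθ))⟩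

lemma refLaw_mem_ball (hm : 0 < m) : A.refLaw ∈ A.ball := by
  refine ⟨A.isProbabilityMeasure_refLaw hm, ?_⟩
  have h := wasserstein_map_le A.Sigma A.refLaw measurable_id
  rw [Measure.map_id] at h
  refine h.trans ?_
  simp [mahalanobis]

lemma integral_Φ_sub_le (hm : 0 < m) {t η : ℝ} (ht : t ≤ A.refQuantile) :
    ∫ s in t..η, (A.Φ s - A.Φ t) ≤
      A.transportCost η + (η - t) * (A.Φ A.refQuantile - A.Φ t) := by
  have hsplit := intervalIntegral.integral_add_adjacent_intervals
    (A.intervalIntegrable_Φ_sub hm (A.Φ t) t A.refQuantile)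
    (A.intervalIntegrable_Φ_sub hm (A.Φ t) A.refQuantile η)
  have h1 : ∫ s in t..A.refQuantile, (A.Φ s - A.Φ t) ≤
      ∫ _ in t..A.refQuantile, (A.Φ A.refQuantile - A.Φ t) :=
    intervalIntegral.integral_mono_on ht (A.intervalIntegrable_Φ_sub hm _ _ _)
      intervalIntegrable_const fun s hs => sub_le_sub_right (A.monotone_Φ hm hs.2) _
  have hΦ := (A.continuous_Φ hm).intervalIntegrable (μ := volume) A.refQuantile η
  have h2 : A.transportCost η =
      (∫ s in A.refQuantile..η, (A.Φ s - A.Φ t)) - (η - A.refQuantile) *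
        (A.Φ A.refQuantile - A.Φ t) := by
    rw [transportCost, ← A.Φ_refQuantile hm,
      intervalIntegral.integral_sub hΦ intervalIntegrable_const,
      intervalIntegral.integral_sub hΦ intervalIntegrable_const,
      intervalIntegral.integral_const, intervalIntegral.integral_const, smul_eq_mul, smul_eq_mul]
    ring
  rw [intervalIntegral.integral_const, smul_eq_mul] at h1
  linarith

/-- Below `etaStar` some law in the ball violates the chance constraint: either the reference law
itself, or the law that raises to just above `η` the reference mass between `η` and a level
slightly below the quantile. -/
lemma exists_measure_lt_of_notMem_etaFeasible (hm : 0 < m) {a : Fin m → ℝ} (ha : a ≠ 0) {η : ℝ}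
    (hη : η ∉ A.etaFeasible) :
    ∃ P ∈ A.ball, P {s | A.score a s ≤ η} < ENNReal.ofReal (1 - A.ε) := by
  have hε : 0 < 1 - A.ε := by linarith [A.ε_lt]
  have hlt : ∀ t < A.refQuantile, ENNReal.ofReal (A.Φ t) < ENNReal.ofReal (1 - A.ε) :=
    fun t ht => (ENNReal.ofReal_lt_ofReal_iff hε).mpr (A.Φ_lt_of_lt_refQuantile hm ht)
  by_cases hq : A.refQuantile ≤ η
  swap
  · refine ⟨A.refLaw, A.refLaw_mem_ball hm, ?_⟩
    rw [A.refLaw_score_le hm ha]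
    exact hlt η (not_le.mp hq)
  have hC : A.transportCost η < A.θ := by
    by_contra h
    rw [A.etaFeasible_eq hm] at hη
    exact hη ⟨hq, not_lt.mp h⟩
  have hcont : Continuous fun δ : ℝ => A.transportCost η +
      (η - (A.refQuantile - δ)) * (A.Φ A.refQuantile - A.Φ (A.refQuantile - δ)) + δ := by
    have := A.continuous_Φ hm
    fun_prop
  have hev : ∀ᶠ δ : ℝ in 𝓝[>] 0, A.transportCost η +
      (η - (A.refQuantile - δ)) * (A.Φ A.refQuantile - A.Φ (A.refQuantile - δ)) + δ < A.θ :=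
    ((hcont.tendsto 0).mono_left nhdsWithin_le_nhds).eventually (gt_mem_nhds (by simpa using hC))
  obtain ⟨δ, hδ, hδ0⟩ := (hev.and eventually_mem_nhdsWithin).exists
  have hδ0 : 0 < δ := hδ0
  have htq : A.refQuantile - δ < A.refQuantile := by linarith
  have htη : A.refQuantile - δ ≤ η := by linarith
  refine ⟨A.refLaw.map (A.raise a (A.refQuantile - δ) η δ),
    A.map_raise_mem_ball hm ha htη hδ0.le (by linarith [A.integral_Φ_sub_le hm (η := η) htq.le]), ?_⟩
  rw [Measure.map_apply (A.measurable_raise a _ η δ)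
    (measurableSet_le (A.measurable_score a) measurable_const)]
  have hset : A.raise a (A.refQuantile - δ) η δ ⁻¹' {s | A.score a s ≤ η} =
      {s | A.score a s ≤ A.refQuantile - δ} := by
    ext s
    exact A.score_raise_le_iff ha htη hδ0 s
  rw [hset, A.refLaw_score_le hm ha]
  exact hlt _ htq

/-- The robust chance constraint for an arbitrary linear functional. -/
lemma forall_ball_le_measure_iff (hm : 0 < m) {a : Fin m → ℝ} (ha : a ≠ 0) (x : ℝ) :
    (∀ P ∈ A.ball, ENNReal.ofReal (1 - A.ε) ≤ P {s | a ⬝ᵥ s ≤ x}) ↔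
      a ⬝ᵥ A.mean + √(a ⬝ᵥ (A.Sigma *ᵥ a)) * A.etaStar ≤ x := by
  have h0 := A.sqrt_dotProduct_pos ha
  set η := (x - a ⬝ᵥ A.mean) / √(a ⬝ᵥ (A.Sigma *ᵥ a)) with hη
  have hset : {s | a ⬝ᵥ s ≤ x} = {s | A.score a s ≤ η} := by
    ext s
    rw [mem_ofPred_eq, mem_ofPred_eq, score, hη, div_le_div_iff_of_pos_right h0, dotProduct_sub,
      sub_le_sub_iff_right]
  have hiff : a ⬝ᵥ A.mean + √(a ⬝ᵥ (A.Sigma *ᵥ a)) * A.etaStar ≤ x ↔ η ∈ A.etaFeasible := by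
    rw [A.mem_etaFeasible_iff hm, hη, le_div_iff₀ h0, le_sub_iff_add_le', mul_comm]
  rw [hset, hiff]
  refine ⟨fun h => ?_, fun h P hP => A.le_measure_of_mem_etaFeasible hm ha h hP⟩
  by_contra hn
  obtain ⟨P, hP, hlt⟩ := A.exists_measure_lt_of_notMem_etaFeasible hm ha hn
  exact absurd (h P hP) (not_le.mpr hlt)

lemma robustLower_iff (hA : A.Invertible) (ν : Fin m) (x : ℝ) :
    A.RobustLower ν x ↔ A.lowerBound ν ≤ x := by
  have hm : 0 < m := Fin.pos ν
  rw [lowerBound, A.Φinv_one_sub_epsLow hm hA]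
  exact A.forall_ball_le_measure_iff hm (by simp) x

/-- The reference law is symmetric, so the upper constraint is the lower one for `-e_ν`. -/
lemma robustUpper_iff (hA : A.Invertible) (ν : Fin m) (x : ℝ) :
    A.RobustUpper ν x ↔ x ≤ A.upperBound ν := by
  have hm : 0 < m := Fin.pos ν
  have h := A.forall_ball_le_measure_iff hm (a := -(Pi.single ν 1 : Fin m → ℝ)) (by simp) (-x)
  simp only [neg_dotProduct, neg_le_neg_iff, Matrix.mulVec_neg, dotProduct_neg, neg_neg] at h
  rw [upperBound, A.Φinv_one_sub_epsLow hm hA]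
  refine Iff.trans h ?_
  constructor <;> intro h' <;> linarith

end Ambiguity

/-! ### The feasible set is a polyhedron -/

/-- `S` is the solution set of finitely many linear inequalities; the index type of the inequalities
is an arbitrary finite type. -/
def IsPolyhedron {ι : Type} [Fintype ι] (S : Set (ι → ℝ)) : Prop :=
  ∃ (κ : Type) (_ : Finite κ) (A : Matrix κ ι ℝ) (b : κ → ℝ), S = {c | A *ᵥ c ≤ b}

section IsPolyhedron

variable {ι : Type} [Fintype ι]

lemma IsPolyhedron.exists_fin {S : Set (ι → ℝ)} (hS : IsPolyhedron S) :
    ∃ (p : ℕ) (A : Matrix (Fin p) ι ℝ) (b : Fin p → ℝ), S = {c | A *ᵥ c ≤ b} := by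
  obtain ⟨κ, _, A, b, rfl⟩ := hS
  obtain ⟨p, ⟨e⟩⟩ := Finite.exists_equiv_fin κ
  refine ⟨p, A.submatrix e.symm id, b ∘ e.symm, ?_⟩
  ext c
  exact (e.symm.forall_congr_right (q := fun k => (A *ᵥ c) k ≤ b k)).symm

lemma isPolyhedron_le (L : (ι → ℝ) →ₗ[ℝ] ℝ) (r : ℝ) : IsPolyhedron {c | L c ≤ r} := by
  classical
  refine ⟨Unit, inferInstance, Matrix.of fun _ i => L (Pi.single i 1), fun _ => r, ?_⟩
  ext c
  have h : (Matrix.of fun (_ : Unit) i => L (Pi.single i 1)) *ᵥ c = fun _ => L c := by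
    ext
    rw [L.pi_apply_eq_sum_univ c]
    simp only [Matrix.mulVec, dotProduct, Matrix.of_apply, smul_eq_mul, mul_comm]
    refine Finset.sum_congr rfl fun i _ => ?_
    congr 2
    ext j
    simp [Pi.single_apply, eq_comm]
  rw [mem_ofPred_eq, mem_ofPred_eq, h]
  exact ⟨fun hc _ => hc, fun hc => hc ()⟩

lemma isPolyhedron_forall {α : Sort*} [Finite α] {p : α → (ι → ℝ) → Prop}
    (h : ∀ x, IsPolyhedron {c | p x c}) : IsPolyhedron {c | ∀ x, p x c} := by
  obtain ⟨n, ⟨e⟩⟩ := Finite.exists_equiv_fin α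
  choose κ hκ A b hS using h
  refine ⟨Σ k : Fin n, κ (e.symm k), inferInstance, Matrix.of fun k => A (e.symm k.1) k.2,
    fun k => b (e.symm k.1) k.2, ?_⟩
  ext c
  have h1 : ∀ x, p x c ↔ A x *ᵥ c ≤ b x := fun x => Set.ext_iff.mp (hS x) c
  simp only [mem_ofPred_eq, h1]
  refine ⟨fun hc k => hc (e.symm k.1) k.2, fun hc x k => ?_⟩
  obtain ⟨j, rfl⟩ := e.symm.surjective x
  exact hc ⟨j, k⟩

lemma IsPolyhedron.and {p q : (ι → ℝ) → Prop} (hp : IsPolyhedron {c | p c})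
    (hq : IsPolyhedron {c | q c}) : IsPolyhedron {c | p c ∧ q c} := by
  have h := isPolyhedron_forall (p := fun (b : Bool) c => if b then p c else q c)
    (by rintro (_ | _) <;> simpa)
  simpa [and_comm] using h

lemma isPolyhedron_ge (L : (ι → ℝ) →ₗ[ℝ] ℝ) (r : ℝ) : IsPolyhedron {c | r ≤ L c} := by
  simpa using isPolyhedron_le (-L) (-r)

lemma isPolyhedron_eq (L : (ι → ℝ) →ₗ[ℝ] ℝ) (r : ℝ) : IsPolyhedron {c | L c = r} := by
  simpa only [le_antisymm_iff] using (isPolyhedron_le L r).and (isPolyhedron_ge L r)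

end IsPolyhedron

/-- Control points of derivatives depend linearly on the control points. -/
lemma exists_linearMap_aPoint {N m n : ℕ} (i : Fin N) (ν : Fin m) (l j : ℕ) :
    ∃ L : (CtrlIdx N m n → ℝ) →ₗ[ℝ] ℝ, ∀ c, L c = aPoint c i ν l j := by
  induction l generalizing j with
  | zero =>
    by_cases h : j < n + 1
    · exact ⟨LinearMap.proj (i, ν, ⟨j, h⟩), fun c => by simp [aPoint, derivPoint, pieceSeq, h]⟩
    · exact ⟨0, fun c => by simp [aPoint, derivPoint, pieceSeq, h]⟩
  | succ l ih =>
    obtain ⟨L₁, h₁⟩ := ih (j + 1)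
    obtain ⟨L₂, h₂⟩ := ih j
    refine ⟨((n.factorial : ℝ) / ((n - (l + 1)).factorial : ℝ)) • (L₁ - L₂), fun c => ?_⟩
    simp [h₁, h₂, aPoint, derivPoint]

namespace TrajData

variable {N m n k : ℕ} (D : TrajData N m n k)

lemma isPolyhedron_commonConstraints : IsPolyhedron {c | D.CommonConstraints c} := by
  choose L hL using fun (i : Fin N) (ν : Fin m) (l j : ℕ) =>
    exists_linearMap_aPoint (n := n) i ν l j
  have hL' : ∀ i ν l j (r : ℝ) c, aPoint c i ν l j * r = (r • L i ν l j) c := by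
    intro i ν l j r c
    rw [LinearMap.smul_apply, hL, smul_eq_mul, mul_comm]
  have h1 : IsPolyhedron {c : CtrlIdx N m n → ℝ | ∀ i : Fin N, ∀ _ : i.val = 0, ∀ ν : Fin m,
      ∀ l : {l // l ≤ n}, aPoint c i ν l 0 * D.τ i ^ (1 - ((l : ℕ) : ℤ)) = D.dInit l ν} := by
    refine isPolyhedron_forall fun i => isPolyhedron_forall fun _ => isPolyhedron_forall fun ν =>
      isPolyhedron_forall fun l => ?_
    simp only [hL']
    exact isPolyhedron_eq _ _
  have h2 : IsPolyhedron {c : CtrlIdx N m n → ℝ | ∀ i : Fin N, ∀ _ : i.val + 1 = N, ∀ ν : Fin m,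
      ∀ l : {l // l ≤ n},
        aPoint c i ν l (n - l) * D.τ i ^ (1 - ((l : ℕ) : ℤ)) = D.dGoal l ν} := by
    refine isPolyhedron_forall fun i => isPolyhedron_forall fun _ => isPolyhedron_forall fun ν =>
      isPolyhedron_forall fun l => ?_
    simp only [hL']
    exact isPolyhedron_eq _ _
  have h3 : IsPolyhedron {c : CtrlIdx N m n → ℝ | ∀ i i' : Fin N, ∀ _ : i.val + 1 = i'.val,
      ∀ ν : Fin m, ∀ l : {l // l < k}, aPoint c i ν l (n - l) * D.τ i ^ (1 - ((l : ℕ) : ℤ)) =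
        aPoint c i' ν l 0 * D.τ i' ^ (1 - ((l : ℕ) : ℤ))} := by
    refine isPolyhedron_forall fun i => isPolyhedron_forall fun i' => isPolyhedron_forall fun _ =>
      isPolyhedron_forall fun ν => isPolyhedron_forall fun l => ?_
    simp only [hL']
    simp only [← sub_eq_zero (b := (_ • L _ _ _ _) _), ← LinearMap.sub_apply]
    exact isPolyhedron_eq _ _
  have h4 : IsPolyhedron {c : CtrlIdx N m n → ℝ | ∀ (i : Fin N) (ν : Fin m) (l : {l // l < k}),
      ∀ _ : 1 ≤ (l : ℕ), ∀ j : {j // j ≤ n - (l : ℕ)},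
        D.aMin l ≤ aPoint c i ν l j * D.τ i ^ (1 - ((l : ℕ) : ℤ)) ∧
          aPoint c i ν l j * D.τ i ^ (1 - ((l : ℕ) : ℤ)) ≤ D.aMax l} := by
    refine isPolyhedron_forall fun i => isPolyhedron_forall fun ν => isPolyhedron_forall fun l =>
      isPolyhedron_forall fun _ => isPolyhedron_forall fun j => ?_
    simp only [hL']
    exact (isPolyhedron_ge _ _).and (isPolyhedron_le _ _)
  have h := (h1.and h2).and (h3.and h4)
  convert h using 1
  ext c
  constructor
  · intro hc
    exact ⟨⟨fun i hi ν l => hc.initial i hi ν l l.2, fun i hi ν l => hc.final i hi ν l l.2⟩,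
      fun i i' hi ν l => hc.continuity i i' hi ν l l.2,
      fun i ν l hl j => hc.limits i ν l hl l.2 j j.2⟩
  · rintro ⟨⟨c1, c2⟩, c3, c4⟩
    exact ⟨fun i hi ν l hl => c1 i hi ν ⟨l, hl⟩, fun i hi ν l hl => c2 i hi ν ⟨l, hl⟩,
      fun i i' hi ν l hl => c3 i i' hi ν ⟨l, hl⟩,
      fun i ν l h1 hl j hj => c4 i ν ⟨l, hl⟩ h1 ⟨j, hj⟩⟩

lemma isPolyhedron_qpFeasible : IsPolyhedron D.qpFeasible := by
  refine IsPolyhedron.and ?_ D.isPolyhedron_commonConstraints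
  refine isPolyhedron_forall fun i => isPolyhedron_forall fun ν => isPolyhedron_forall fun j => ?_
  exact (isPolyhedron_ge (LinearMap.proj (i, ν, j)) _).and
    (isPolyhedron_le (LinearMap.proj (i, ν, j)) _)

lemma isConvexQP : IsConvexQP D.objective D.qpFeasible :=
  ⟨⟨D.Q, 0, 0, D.Q_posDef.posSemidef, fun c => by simp [objective]⟩,
    D.isPolyhedron_qpFeasible.exists_fin⟩

lemma robustFeasible_eq_qpFeasible (hlower : ∀ i, (D.lower i).Invertible)
    (hupper : ∀ i, (D.upper i).Invertible) : D.robustFeasible = D.qpFeasible := by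
  ext c
  refine and_congr_left fun _ => forall_congr' fun i => forall_congr' fun ν => forall_congr' fun j =>
    and_congr ((D.lower i).robustLower_iff (hlower i) ν _)
      ((D.upper i).robustUpper_iff (hupper i) ν _)

end TrajData

end DRSCC

theorem theorem1 {N m n k : ℕ} (hm : 0 < m) (D : DRSCC.TrajData N m n k)
    (hlower : ∀ i, (D.lower i).Invertible) (hupper : ∀ i, (D.upper i).Invertible) :
    -- `η*` is attained and the risk level is tightened
    (∀ i, IsLeast (D.lower i).etaFeasible (D.lower i).etaStar ∧
      (D.lower i).epsLow ≤ (D.lower i).ε) ∧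
    (∀ i, IsLeast (D.upper i).etaFeasible (D.upper i).etaStar ∧
      (D.upper i).epsLow ≤ (D.upper i).ε) ∧
    -- each robust chance constraint is a deterministic linear bound
    (∀ i ν x, (D.lower i).RobustLower ν x ↔ (D.lower i).lowerBound ν ≤ x) ∧
    (∀ i ν x, (D.upper i).RobustUpper ν x ↔ x ≤ (D.upper i).upperBound ν) ∧
    -- the two problems are equivalent
    D.robustFeasible = D.qpFeasible ∧
    DRSCC.minimizers D.objective D.robustFeasible = DRSCC.minimizers D.objective D.qpFeasible ∧
    DRSCC.optValue D.objective D.robustFeasible = DRSCC.optValue D.objective D.qpFeasible ∧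
    -- the deterministic problem is a convex quadratic program
    DRSCC.IsConvexQP D.objective D.qpFeasible := by
  have hfeas := D.robustFeasible_eq_qpFeasible hlower hupper
  exact ⟨fun i => ⟨(D.lower i).isLeast_etaStar hm, (D.lower i).epsLow_le hm⟩,
    fun i => ⟨(D.upper i).isLeast_etaStar hm, (D.upper i).epsLow_le hm⟩,
    fun i => (D.lower i).robustLower_iff (hlower i), fun i => (D.upper i).robustUpper_iff (hupper i),
    hfeas, by rw [hfeas], by rw [hfeas], D.isConvexQP⟩
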